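/- Let $K$ be a finite field, let $F$ be a quadratic extension field of the rational function field $K(x)$ (separable or not), and let $\mathcal{O}_F$ be the integral closure of $K[x]$ in $F$. For a ring $R$ with identity and a positive integer $k$, call $R$ $k$-good if every element of $R$ is a sum of exactly $k$ units of $R$. The unit sum number $u(R)$ is the least positive integer $k$ such that $R$ is $k$-good, if such a $k$ exists; if no such $k$ exists, then $u(R) := \omega$ if $R$ is additively generated by its units, and $u(R) := \infty$ otherwise. Places of $F | K$ are the maximal ideals of the discrete valuation rings with field of fractions $F$ that contain $K$; for a place $P$, let $v_P$ be its normalized valuation and $\deg P$ the degree over $K$ of its residue class field. For a divisor $A$ of $F | K$ (an element of the free abelian group on the places), let $L(A)$ be the $K$-vector space of all $f \in F$ with $v_P(f) \geq -A(P)$ for all places $P$. The genus of $F | K$ is $\max_A (\deg A - \dim_K L(A) + 1)$, the maximum being taken over all divisors $A$. Then the following two statements are equivalent. (a) $u(\mathcal{O}_F) = \omega$. (b) The function field $F | K$ has full constant field $K$ (that is, $K$ is algebraically closed in $F$) and genus $0$, and the infinite place of $K(x)$ splits into two places of $F | K$ (that is, exactly two places of $F | K$ lie over it). -/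

import Mathlib

open scoped Polynomial RatFunc WithZero

noncomputable section

/-! ### Unit sum numbers -/

/-- `r` is `k`-good: it is a sum of exactly `k` units. -/
def IsGoodElement {R : Type*} [Ring R] (k : ℕ) (r : R) : Prop :=
  ∃ e : Fin k → Rˣ, r = ∑ i, (e i : R)

/-- The ring `R` is `k`-good: every element is a sum of exactly `k` units. -/
def IsGoodRing (R : Type*) [Ring R] (k : ℕ) : Prop :=
  ∀ r : R, IsGoodElement k r

/-- The units of `R` generate `R` additively. -/
def UnitsGenerateAdditively (R : Type*) [Ring R] : Prop :=
  AddSubgroup.closure {r : R | IsUnit r} = ⊤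

/-- Values of the unit sum number: natural numbers, `ω`, `∞`. -/
abbrev UnitSumValue : Type := WithTop (WithTop ℕ)

/-- The value `ω`, larger than every natural number and smaller than `∞ = ⊤`. -/
def UnitSumValue.omega : UnitSumValue := WithTop.some (⊤ : WithTop ℕ)

open Classical in
/-- The unit sum number `u(R)`: the least positive `k` such that `R` is `k`-good, if there is one;
otherwise `ω` if the units generate `R` additively, and `∞` if they do not. -/
def unitSumNumber (R : Type*) [Ring R] : UnitSumValue :=
  if h : ∃ k : ℕ, 0 < k ∧ IsGoodRing R k then
    WithTop.some (WithTop.some (Nat.find h))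
  else if UnitsGenerateAdditively R then UnitSumValue.omega
  else ⊤

/-! ### Places, divisors and the genus of a function field -/

/-- A place of `F | K`, given by its valuation ring: a discrete valuation ring with field of
fractions `F` that contains `K`. The place itself is the maximal ideal of that ring. -/
@[ext]
structure Place (K F : Type*) [Field K] [Field F] [Algebra K F] where
  /-- the valuation ring of the place -/
  ring : ValuationSubring F
  algebraMap_mem : ∀ c : K, algebraMap K F c ∈ ring
  isDVR : IsDiscreteValuationRing ring

namespace Place

variable {K F : Type*} [Field K] [Field F] [Algebra K F]

instance (P : Place K F) : IsDiscreteValuationRing P.ring := P.isDVR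

instance (P : Place K F) : Algebra K P.ring :=
  ((algebraMap K F).codRestrict P.ring.toSubring P.algebraMap_mem).toAlgebra

/-- The normalized valuation at `P`, written multiplicatively: for `f ≠ 0` its value is
`exp (-v_P(f))`, where `v_P : F → ℤ ∪ {∞}` is the surjective discrete valuation at `P`. -/
def valuation (P : Place K F) : Valuation F ℤᵐ⁰ :=
  (IsDiscreteValuationRing.maximalIdeal P.ring).valuation F

/-- The degree of `P`: the degree over `K` of the residue class field at `P`. -/
def degree (P : Place K F) : ℕ :=
  Module.finrank K (IsLocalRing.ResidueField P.ring)

end Place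

/-- Divisors of `F | K`: the free abelian group on the places. -/
abbrev PlaceDivisor (K F : Type*) [Field K] [Field F] [Algebra K F] : Type _ :=
  Place K F →₀ ℤ

namespace PlaceDivisor

variable {K F : Type*} [Field K] [Field F] [Algebra K F]

/-- The degree `∑ A(P) · deg P` of a divisor `A`. -/
def degree (A : PlaceDivisor K F) : ℤ :=
  A.sum fun P n => n * (P.degree : ℤ)

theorem valuation_algebraMap_le_one (P : Place K F) (c : K) :
    P.valuation (algebraMap K F c) ≤ 1 :=
  (IsDiscreteValuationRing.maximalIdeal P.ring).valuation_le_one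
    (⟨algebraMap K F c, P.algebraMap_mem c⟩ : P.ring)

/-- The Riemann-Roch space `L(A)`: the `f ∈ F` with `v_P(f) ≥ -A(P)` for all places `P`
(this includes `f = 0`), as a `K`-vector space. -/
def riemannRochSpace (A : PlaceDivisor K F) : Submodule K F where
  carrier := {f : F | ∀ P : Place K F, P.valuation f ≤ WithZero.exp (A P)}
  zero_mem' := fun P => by simp
  add_mem' := fun {f g} hf hg P => (P.valuation.map_add f g).trans (max_le (hf P) (hg P))
  smul_mem' := fun c f hf P => by
    rw [Algebra.smul_def, map_mul]
    exact (mul_le_mul' (valuation_algebraMap_le_one P c) (hf P)).trans_eq (one_mul _)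

end PlaceDivisor

/-- The function field `F | K` has genus `g`, that is,
`g = max {deg A - dim_K L(A) + 1 | A a divisor of F | K}`. -/
def HasGenus (K F : Type*) [Field K] [Field F] [Algebra K F] (g : ℤ) : Prop :=
  IsGreatest
    {n : ℤ | ∃ A : PlaceDivisor K F, n = A.degree - (Module.finrank K A.riemannRochSpace : ℤ) + 1}
    g

/-! ### The infinite place of `K(x)` -/

open Classical in
instance (K : Type*) [Field K] :
    IsDiscreteValuationRing (RatFunc.inftyValuation K).valuationSubring := by
  infer_instance

open Classical in
/-- The infinite place of `K(x)`; its valuation ring consists of the fractions `f / g` with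
`deg f ≤ deg g`. -/
def inftyPlace (K : Type*) [Field K] : Place K K⟮X⟯ where
  ring := (RatFunc.inftyValuation K).valuationSubring
  algebraMap_mem := fun c => by
    rw [Valuation.mem_valuationSubring_iff]
    exact Valuation.IsTrivialOn.valuation_algebraMap_le_one _ c
  isDVR := inferInstance

/-- The place `Q` of `F | K` lies over the place `P` of `E | K`, for an extension `F` of `E`:
the valuation ring of `P` is the preimage in `E` of that of `Q`. -/
def Place.LiesOver {K E F : Type*} [Field K] [Field E] [Field F] [Algebra K E] [Algebra K F]
    [Algebra E F] (Q : Place K F) (P : Place K E) : Prop :=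
  Q.ring.comap (algebraMap E F) = P.ring

end

/-! Everything rests on the units of the integral closure, studied with the conjugation of F over
K(x), which exists even in the inseparable case (`QuadraticConj`). The norm of a unit is a nonzero
constant, so a unit with constant trace is algebraic over K.

Suppose the units generate. As x is transcendental, some unit has nonconstant trace; let ε be one
with trace of minimal degree. Descent on the degree of the trace writes every unit as an algebraic
element times a power of ε (`exists_fundamental_unit`). A constant outside K would turn the norm
equation of a unit into a form that splits over F[X] into factors of degree 0, making all traces
constant (`algebraicClosure_eq_bot`). Hence the units are c ε ^ k with c in K, so F = K(ε) is
rational, of genus 0. The places above infinity are exactly the pole and the zero of ε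
(`ncard_liesOver_inftyPlace`).

Conversely, let P and Q be the two places above infinity. They are conjugate and of degree 1. Genus
0 forces L(P - Q) to be nonzero, which yields a unit t with a simple pole at P and a simple zero at
Q (`exists_unit_of_hasGenus_zero`). Subtracting multiples of powers of t removes the poles of an
integral element until a constant remains (`mem_closure_of_valuation_le`). All units being c t ^ k,
linear independence of the powers of t prevents k units from summing to 1 + t + ... + t ^ k. -/

theorem ne_zero_of_valuation_eq_exp {F : Type*} [Field F] {v : Valuation F ℤᵐ⁰} {f : F} {n : ℤ}
    (h : v f = WithZero.exp n) : f ≠ 0 := by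
  rintro rfl
  rw [map_zero] at h
  exact WithZero.exp_ne_zero h.symm

/-! ### Places and their normalized valuations -/

namespace Place

variable {K F : Type*} [Field K] [Field F] [Algebra K F]

theorem valuation_le_one_iff (P : Place K F) {f : F} : P.valuation f ≤ 1 ↔ f ∈ P.ring := by
  constructor
  · intro h
    obtain ⟨a, rfl⟩ := IsDiscreteValuationRing.exists_lift_of_le_one h
    exact a.2
  · intro h
    exact (IsDiscreteValuationRing.maximalIdeal P.ring).valuation_le_one (⟨f, h⟩ : P.ring)

theorem valuation_surjective (P : Place K F) : Function.Surjective P.valuation :=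
  (IsDiscreteValuationRing.maximalIdeal P.ring).valuation_surjective F

theorem valuation_lt_one_iff (P : Place K F) (f : P.ring) :
    P.valuation f < 1 ↔ f ∈ IsLocalRing.maximalIdeal P.ring :=
  (IsDiscreteValuationRing.maximalIdeal P.ring).valuation_lt_one_iff_mem (K := F) f

/-- A nonzero value in `ℤᵐ⁰` is an integral power of `exp 1`. -/
theorem exists_valuation_eq_exp (P : Place K F) {f : F} (hf : f ≠ 0) :
    ∃ n : ℤ, P.valuation f = WithZero.exp n :=
  ⟨WithZero.log (P.valuation f), (WithZero.exp_log (by simpa using hf)).symm⟩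

theorem valuation_algebraMap (P : Place K F) {c : K} (hc : c ≠ 0) :
    P.valuation (algebraMap K F c) = 1 := by
  apply le_antisymm (PlaceDivisor.valuation_algebraMap_le_one P c)
  have := PlaceDivisor.valuation_algebraMap_le_one P c⁻¹
  rw [map_inv₀, map_inv₀] at this
  exact (inv_le_one₀ (by simpa [zero_lt_iff] using hc)).1 this

/-- The normalized valuation is the only surjective valuation with the given valuation ring. -/
theorem eq_valuation (P : Place K F) (w : Valuation F ℤᵐ⁰) (hw : Function.Surjective w)
    (h : ∀ f, w f ≤ 1 ↔ f ∈ P.ring) : w = P.valuation := by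
  have hle : ∀ f, w f ≤ 1 ↔ P.valuation f ≤ 1 := fun f => by rw [h, valuation_le_one_iff]
  have hE : w.IsEquiv P.valuation := Valuation.isEquiv_iff_val_le_one.2 fun {x} => hle x
  obtain ⟨p, hp⟩ := P.valuation_surjective (WithZero.exp (-1))
  obtain ⟨q, hq⟩ := hw (WithZero.exp (-1))
  have hp0 : p ≠ 0 := ne_zero_of_valuation_eq_exp hp
  have hq0 : q ≠ 0 := ne_zero_of_valuation_eq_exp hq
  -- Dividing f by a power of the uniformizer p leaves an element of value 1, and equivalent
  -- valuations agree on those.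
  have key : ∀ (v v' : Valuation F ℤᵐ⁰) (p : F), v.IsEquiv v' → v p = WithZero.exp (-1) →
      ∀ f, f ≠ 0 → ∃ j : ℤ, v f = WithZero.exp (-j) ∧ v' f = v' p ^ j := by
    intro v v' p e hp f hf
    have hp0 : p ≠ 0 := ne_zero_of_valuation_eq_exp hp
    refine ⟨-WithZero.log (v f), ?_, ?_⟩
    · rw [neg_neg, WithZero.exp_log (by simpa using hf)]
    · have h1 : v (f / p ^ (-WithZero.log (v f))) = 1 := by
        have : v f ≠ 0 := by simpa using hf
        rw [map_div₀, map_zpow₀, hp, ← WithZero.exp_zsmul]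
        simp [WithZero.exp_log this, this]
      rw [(Valuation.isEquiv_iff_val_eq_one.1 e), map_div₀, map_zpow₀, div_eq_one_iff_eq] at h1
      · exact h1
      · simpa using zpow_ne_zero _ (by simpa using hp0)
  obtain ⟨j, hj1, hj2⟩ := key _ _ p hE.symm hp q hq0
  -- Since w q = exp (-1) is a power of w p, the exponent of w p divides 1; its sign is fixed by w p
  -- < 1.
  have hwp : w p = WithZero.exp (-1) := by
    obtain ⟨m, hm⟩ : ∃ m : ℤ, w p = WithZero.exp m :=
      ⟨WithZero.log (w p), (WithZero.exp_log (by simpa using hp0)).symm⟩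
    rw [hq, hm, ← WithZero.exp_zsmul, WithZero.exp_inj] at hj2
    have hm0 : w p < 1 := by
      rw [Valuation.isEquiv_iff_val_lt_one.1 hE, hp, ← WithZero.exp_zero]
      exact WithZero.exp_lt_exp.2 (by norm_num)
    rw [hm, ← WithZero.exp_zero, WithZero.exp_lt_exp] at hm0
    rw [hm]
    congr 1
    have h2 : (-m) * j = 1 := by simp at hj2; linarith [mul_comm m j]
    have := Int.eq_one_or_neg_one_of_mul_eq_one h2
    omega
  ext f
  rcases eq_or_ne f 0 with rfl | hf
  · simp
  obtain ⟨j, h1, h2⟩ := key _ _ p hE.symm hp f hf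
  rw [h1, h2, hwp, ← WithZero.exp_zsmul]
  simp

theorem ext_of_valuation {P Q : Place K F} (h : P.valuation = Q.valuation) : P = Q := by
  ext f
  rw [← valuation_le_one_iff, h, valuation_le_one_iff]

/-- There are no proper inclusions between the valuation rings of places. -/
theorem eq_of_ring_le {P Q : Place K F} (h : P.ring ≤ Q.ring) : P = Q := by
  by_contra hne
  have hlt : ¬ Q.ring ≤ P.ring := fun h' => hne (Place.ext (le_antisymm h h'))
  obtain ⟨f, hfQ, hfP⟩ := SetLike.not_le_iff_exists.1 hlt
  rw [← valuation_le_one_iff, not_le] at hfP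
  have hf0 : f ≠ 0 := by rintro rfl; simp at hfP
  obtain ⟨n, hn⟩ := P.exists_valuation_eq_exp hf0
  rw [hn, ← WithZero.exp_zero, WithZero.exp_lt_exp] at hfP
  -- f has a pole at P but lies in the ring of Q. A power of f absorbs the pole of g at P, so the
  -- ring of Q would be all of F.
  have htop : ∀ g : F, g ∈ Q.ring := by
    intro g
    rcases eq_or_ne g 0 with rfl | hg
    · exact zero_mem _
    obtain ⟨m, hm⟩ := P.exists_valuation_eq_exp hg
    have h1 : g / f ^ m.toNat ∈ P.ring := by
      rw [← valuation_le_one_iff, map_div₀, map_pow, hm, hn, ← WithZero.exp_nsmul,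
        ← WithZero.exp_sub, ← WithZero.exp_zero, WithZero.exp_le_exp]
      have := Int.self_le_toNat m
      simp only [nsmul_eq_mul]
      nlinarith
    have h2 := mul_mem (h h1) (pow_mem hfQ m.toNat)
    rwa [div_mul_cancel₀ _ (pow_ne_zero _ hf0)] at h2
  obtain ⟨g, hg⟩ := Q.valuation_surjective (WithZero.exp 1)
  have := Q.valuation_le_one_iff.2 (htop g)
  rw [hg, ← WithZero.exp_zero, WithZero.exp_le_exp] at this
  omega

/-- The place given by a surjective valuation which is trivial on the constants. -/
noncomputable def ofValuation (w : Valuation F ℤᵐ⁰) (hw : Function.Surjective w)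
    (hK : ∀ c : K, w (algebraMap K F c) ≤ 1) : Place K F where
  ring := w.valuationSubring
  algebraMap_mem := hK
  isDVR := by
    have : w.IsNontrivial := by
      obtain ⟨g, hg⟩ := hw (WithZero.exp 1)
      exact ⟨g, by rw [hg]; exact WithZero.exp_ne_zero, by
        rw [hg, ← WithZero.exp_zero]; simp⟩
    infer_instance

@[simp]
theorem valuation_ofValuation (w : Valuation F ℤᵐ⁰) (hw : Function.Surjective w)
    (hK : ∀ c : K, w (algebraMap K F c) ≤ 1) : (ofValuation w hw hK).valuation = w :=
  (eq_valuation _ w hw fun _ => Iff.rfl).symm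

variable {F' : Type*} [Field F'] [Algebra K F']

/-- The preimage of a place under an isomorphism of extensions of `K`. -/
noncomputable def comap (e : F ≃ₐ[K] F') (P : Place K F') : Place K F :=
  ofValuation (P.valuation.comap (e : F →+* F'))
    (P.valuation_surjective.comp e.surjective)
    (fun c => by simpa using PlaceDivisor.valuation_algebraMap_le_one P c)

@[simp]
theorem valuation_comap (e : F ≃ₐ[K] F') (P : Place K F') (f : F) :
    (P.comap e).valuation f = P.valuation (e f) := by
  exact DFunLike.congr_fun (valuation_ofValuation _ _ _) f

theorem mem_comap (e : F ≃ₐ[K] F') (P : Place K F') (f : F) :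
    f ∈ (P.comap e).ring ↔ e f ∈ P.ring := by
  rw [← valuation_le_one_iff, valuation_comap, valuation_le_one_iff]

/-- An isomorphism of extensions of `K` identifies the places. -/
noncomputable def congr (e : F ≃ₐ[K] F') : Place K F ≃ Place K F' where
  toFun := comap e.symm
  invFun := comap e
  left_inv P := ext_of_valuation (by ext; simp)
  right_inv P := ext_of_valuation (by ext; simp)

theorem degree_comap (e : F ≃ₐ[K] F') (P : Place K F') : (P.comap e).degree = P.degree := by
  let r : (P.comap e).ring ≃+* P.ring :=
    { toFun := fun f => ⟨e f, (mem_comap e P f).1 f.2⟩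
      invFun := fun f => ⟨e.symm f, (mem_comap e P _).2 (by simp)⟩
      left_inv := fun f => by simp
      right_inv := fun f => by simp
      map_mul' := fun f g => by ext; simp
      map_add' := fun f g => by ext; simp }
  let a : (P.comap e).ring ≃ₐ[K] P.ring :=
    AlgEquiv.ofRingEquiv (f := r) (fun c => Subtype.ext (e.commutes c))
  exact (IsLocalRing.ResidueField.mapAlgEquiv a).toLinearEquiv.finrank_eq

theorem degree_eq_one (P : Place K F)
    (h : ∀ f, P.valuation f ≤ 1 → ∃ c : K, P.valuation (f - algebraMap K F c) < 1) :
    P.degree = 1 := by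
  have hs : Function.Surjective (algebraMap K (IsLocalRing.ResidueField P.ring)) := by
    intro y
    obtain ⟨f, rfl⟩ := IsLocalRing.residue_surjective y
    obtain ⟨c, hc⟩ := h f (P.valuation_le_one_iff.2 f.2)
    refine ⟨c, ?_⟩
    have := (P.valuation_lt_one_iff (f - algebraMap K P.ring c)).1 hc
    rw [← IsLocalRing.residue_eq_zero_iff, map_sub, sub_eq_zero] at this
    exact this.symm
  exact ((AlgEquiv.ofBijective (Algebra.ofId K _)
    ⟨(algebraMap K _).injective, hs⟩).toLinearEquiv.finrank_eq).symm.trans (Module.finrank_self K)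

end Place

/-! ### Divisors and linear equivalence -/

namespace PlaceDivisor

variable {K F : Type*} [Field K] [Field F] [Algebra K F]

theorem degree_add (A B : PlaceDivisor K F) : (A + B).degree = A.degree + B.degree :=
  Finsupp.sum_add_index' (by simp) (by intros; ring)

theorem degree_single (P : Place K F) (n : ℤ) :
    degree (Finsupp.single P n : PlaceDivisor K F) = n * P.degree :=
  Finsupp.sum_single_index (by simp)

theorem mem_riemannRochSpace {A : PlaceDivisor K F} {f : F} :
    f ∈ A.riemannRochSpace ↔ ∀ P : Place K F, P.valuation f ≤ WithZero.exp (A P) := Iff.rfl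

/-- Multiplication by a function with divisor `-B` identifies `L(A)` and `L(A + B)`. -/
theorem finrank_riemannRochSpace_add (A B : PlaceDivisor K F) (h : F) (h0 : h ≠ 0)
    (hB : ∀ P : Place K F, P.valuation h = WithZero.exp (B P)) :
    Module.finrank K (A + B).riemannRochSpace = Module.finrank K A.riemannRochSpace := by
  have hmap : A.riemannRochSpace.map (LinearMap.mulLeft K h) = (A + B).riemannRochSpace := by
    ext f
    simp only [Submodule.mem_map, LinearMap.mulLeft_apply, mem_riemannRochSpace]
    constructor
    · rintro ⟨g, hg, rfl⟩ P
      rw [map_mul, hB, Finsupp.add_apply, WithZero.exp_add, mul_comm]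
      exact mul_le_mul_left (hg P) _
    · intro hf
      refine ⟨f / h, fun P => ?_, mul_div_cancel₀ _ h0⟩
      rw [map_div₀, hB, div_eq_mul_inv]
      refine (mul_le_mul_left (hf P) _).trans_eq ?_
      rw [← WithZero.exp_neg, ← WithZero.exp_add, Finsupp.add_apply]
      congr 1
      ring
  rw [← hmap]
  exact (Submodule.equivMapOfInjective (LinearMap.mulLeft K h)
    (mul_right_injective₀ h0) _).finrank_eq.symm

end PlaceDivisor

/-! ### Invariance of the genus under isomorphism -/

section Transport

variable {K F F' : Type*} [Field K] [Field F] [Algebra K F] [Field F'] [Algebra K F']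

theorem HasGenus.of_algEquiv (e : F ≃ₐ[K] F') {g : ℤ} (h : HasGenus K F g) : HasGenus K F' g := by
  have key : {n : ℤ | ∃ A : PlaceDivisor K F, n = A.degree -
      (Module.finrank K A.riemannRochSpace : ℤ) + 1} =
      {n : ℤ | ∃ A : PlaceDivisor K F', n = A.degree -
      (Module.finrank K A.riemannRochSpace : ℤ) + 1} := by
    have hdeg : ∀ A : PlaceDivisor K F,
        PlaceDivisor.degree (Finsupp.equivMapDomain (Place.congr e) A) = A.degree := by
      intro A
      rw [PlaceDivisor.degree, Finsupp.equivMapDomain_eq_mapDomain, Finsupp.sum_mapDomain_index]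
      · refine Finsupp.sum_congr fun P _ => ?_
        rw [show (Place.congr e P).degree = P.degree from Place.degree_comap e.symm P]
      · simp
      · intros; ring
    have hrank : ∀ A : PlaceDivisor K F,
        Module.finrank K (PlaceDivisor.riemannRochSpace
          (Finsupp.equivMapDomain (Place.congr e) A)) =
        Module.finrank K A.riemannRochSpace := by
      intro A
      have hmap : A.riemannRochSpace.map e.toLinearMap =
          PlaceDivisor.riemannRochSpace (Finsupp.equivMapDomain (Place.congr e) A) := by
        ext f
        simp only [Submodule.mem_map, PlaceDivisor.mem_riemannRochSpace,
          AlgEquiv.toLinearMap_apply, Finsupp.equivMapDomain_apply]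
        constructor
        · rintro ⟨g, hg, rfl⟩ P
          have := hg ((Place.congr e).symm P)
          rwa [show (Place.congr e).symm P = P.comap e from rfl, Place.valuation_comap] at this
        · intro hf
          refine ⟨e.symm f, fun P => ?_, e.apply_symm_apply f⟩
          have := hf (Place.congr e P)
          rwa [Equiv.symm_apply_apply, show Place.congr e P = P.comap e.symm from rfl,
            Place.valuation_comap] at this
      rw [← hmap]
      exact (Submodule.equivMapOfInjective e.toLinearMap e.injective _).finrank_eq.symm
    ext n
    constructor
    · rintro ⟨A, rfl⟩
      exact ⟨_, by rw [hdeg, hrank]⟩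
    · rintro ⟨A, rfl⟩
      refine ⟨Finsupp.equivMapDomain (Place.congr e).symm A, ?_⟩
      have hA : Finsupp.equivMapDomain (Place.congr e)
          (Finsupp.equivMapDomain (Place.congr e).symm A) = A := by
        rw [← Finsupp.equivMapDomain_trans, Equiv.symm_trans_self, Finsupp.equivMapDomain_refl]
      rw [← hdeg, ← hrank, hA]
  unfold HasGenus at h ⊢
  exact key ▸ h

end Transport

/-! ### Places, divisors and genus of K(x) -/

section RationalFunctionField

variable {K : Type*} [Field K]

instance Place.isTrivialOn_valuation {F : Type*} [Field F] [Algebra K F] (P : Place K F) :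
    P.valuation.IsTrivialOn K :=
  ⟨fun _ hc => P.valuation_algebraMap hc⟩

instance Place.isRankOneDiscrete_valuation {F : Type*} [Field F] [Algebra K F] (P : Place K F) :
    P.valuation.IsRankOneDiscrete :=
  inferInstanceAs ((IsDiscreteValuationRing.maximalIdeal P.ring).valuation F).IsRankOneDiscrete

open Classical in
theorem valuation_inftyPlace : (inftyPlace K).valuation = RatFunc.inftyValuation K := by
  refine (Place.eq_valuation _ _ ?_ fun _ => Iff.rfl).symm
  intro x
  rcases eq_or_ne x 0 with rfl | hx
  · exact ⟨0, map_zero _⟩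
  · exact ⟨RatFunc.X ^ (WithZero.log x), by
      rw [RatFunc.inftyValuation.X_zpow, WithZero.exp_log hx]⟩

theorem valuation_inftyPlace_of_ne_zero {f : K⟮X⟯} (hf : f ≠ 0) :
    (inftyPlace K).valuation f = WithZero.exp f.intDegree := by
  classical
  rw [valuation_inftyPlace, RatFunc.inftyValuation_apply]
  convert RatFunc.inftyValuation_of_nonzero K hf

theorem valuation_inftyPlace_algebraMap {p : K[X]} (hp : p ≠ 0) :
    (inftyPlace K).valuation (algebraMap K[X] K⟮X⟯ p) = WithZero.exp (p.natDegree : ℤ) := by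
  rw [valuation_inftyPlace_of_ne_zero (by simpa), RatFunc.intDegree_polynomial]

theorem one_lt_valuation_inftyPlace_X : 1 < (inftyPlace K).valuation RatFunc.X := by
  rw [valuation_inftyPlace_of_ne_zero RatFunc.X_ne_zero, RatFunc.intDegree_X, ← WithZero.exp_zero,
    WithZero.exp_lt_exp]
  norm_num

theorem exists_valuation_inftyPlace_sub_lt_one (f : K⟮X⟯) (hf : (inftyPlace K).valuation f ≤ 1) :
    ∃ c : K, (inftyPlace K).valuation (f - algebraMap K K⟮X⟯ c) < 1 := by
  rcases hf.lt_or_eq with hlt | heq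
  · exact ⟨0, by simpa using hlt⟩
  have hf0 : f ≠ 0 := by rintro rfl; simp at heq
  have hdeg : f.num.natDegree = f.denom.natDegree := by
    rw [valuation_inftyPlace_of_ne_zero hf0, ← WithZero.exp_zero, WithZero.exp_inj,
      RatFunc.intDegree] at heq
    omega
  have hn0 : f.num ≠ 0 := by simpa using hf0
  have hd0 : f.denom ≠ 0 := f.denom_ne_zero
  -- The value of f at infinity is the quotient of the leading coefficients, and `f.denom` is monic.
  refine ⟨f.num.leadingCoeff, ?_⟩
  set g := f.num - Polynomial.C f.num.leadingCoeff * f.denom with hg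
  have hfg : f - algebraMap K K⟮X⟯ f.num.leadingCoeff =
      algebraMap K[X] K⟮X⟯ g / algebraMap K[X] K⟮X⟯ f.denom := by
    have hd : algebraMap K[X] K⟮X⟯ f.denom ≠ 0 := by simpa
    rw [eq_div_iff hd, sub_mul]
    nth_rewrite 1 [← f.num_div_denom]
    rw [div_mul_cancel₀ _ hd, hg, map_sub, map_mul]
    rfl
  rcases eq_or_ne g 0 with hg0 | hg0
  · rw [hfg, hg0]; simp
  rw [hfg, map_div₀, valuation_inftyPlace_algebraMap hg0, valuation_inftyPlace_algebraMap hd0,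
    ← WithZero.exp_sub, ← WithZero.exp_zero, WithZero.exp_lt_exp, sub_neg, Nat.cast_lt, ← hdeg]
  apply Polynomial.natDegree_lt_natDegree hg0
  have hc : f.num.leadingCoeff ≠ 0 := by simpa using hf0
  apply Polynomial.degree_sub_lt_left _ hn0
  · simp [f.monic_denom.leadingCoeff]
  · rw [Polynomial.degree_C_mul hc, Polynomial.degree_eq_natDegree hn0,
      Polynomial.degree_eq_natDegree hd0, hdeg]

theorem degree_inftyPlace : (inftyPlace K).degree = 1 :=
  Place.degree_eq_one _ exists_valuation_inftyPlace_sub_lt_one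

open IsDedekindDomain

/-- The place of `K(x)` at a maximal ideal of `K[x]`. -/
noncomputable def adicPlace (v : HeightOneSpectrum K[X]) : Place K K⟮X⟯ :=
  Place.ofValuation (v.valuation K⟮X⟯) (v.valuation_surjective _) fun c =>
    v.valuation_le_one (Polynomial.C c)

theorem valuation_adicPlace (v : HeightOneSpectrum K[X]) :
    (adicPlace v).valuation = v.valuation K⟮X⟯ :=
  Place.valuation_ofValuation _ _ _

theorem eq_inftyPlace_of_one_lt (P : Place K K⟮X⟯) (h : 1 < P.valuation RatFunc.X) :
    P = inftyPlace K := by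
  classical
  have := RatFunc.valuation_isEquiv_inftyValuation_of_one_lt_valuation_X h
  refine Place.ext (SetLike.ext fun f => ?_)
  rw [← Place.valuation_le_one_iff, Valuation.isEquiv_iff_val_le_one.1 this,
    ← Place.valuation_le_one_iff, valuation_inftyPlace]

theorem exists_eq_adicPlace (P : Place K K⟮X⟯) (h : P.valuation RatFunc.X ≤ 1) :
    ∃ v, P = adicPlace v := by
  obtain ⟨v, hv⟩ := RatFunc.valuation_isEquiv_adic_of_valuation_X_le_one h
  refine ⟨v, Place.ext (SetLike.ext fun f => ?_)⟩
  rw [← Place.valuation_le_one_iff, Valuation.isEquiv_iff_val_le_one.1 hv,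
    ← Place.valuation_le_one_iff, valuation_adicPlace]

theorem eq_inftyPlace_or_adicPlace (P : Place K K⟮X⟯) : P = inftyPlace K ∨ ∃ v, P = adicPlace v :=
  (lt_or_ge 1 (P.valuation RatFunc.X)).imp (eq_inftyPlace_of_one_lt P) (exists_eq_adicPlace P)

theorem adicPlace_injective : Function.Injective (adicPlace (K := K)) := by
  intro v w h
  have := congrArg Place.valuation h
  rw [valuation_adicPlace, valuation_adicPlace] at this
  exact HeightOneSpectrum.eq_of_valuation_isEquiv_valuation (K := K⟮X⟯) (by rw [this])

theorem adicPlace_ne_inftyPlace (v : HeightOneSpectrum K[X]) : adicPlace v ≠ inftyPlace K := by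
  intro h
  have h1 := one_lt_valuation_inftyPlace_X (K := K)
  rw [← h, valuation_adicPlace, ← RatFunc.algebraMap_X] at h1
  exact absurd (v.valuation_le_one _) (not_le.2 h1)

/-- A generator of a maximal ideal of `K[x]`. -/
noncomputable def maxGenerator (v : HeightOneSpectrum K[X]) : K[X] :=
  Submodule.IsPrincipal.generator v.asIdeal

theorem span_maxGenerator (v : HeightOneSpectrum K[X]) :
    Ideal.span {maxGenerator v} = v.asIdeal :=
  v.asIdeal.span_singleton_generator

theorem maxGenerator_ne_zero (v : HeightOneSpectrum K[X]) : maxGenerator v ≠ 0 := by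
  intro h
  apply v.ne_bot
  rw [← span_maxGenerator, h]
  simp

theorem valuation_adicPlace_maxGenerator (v : HeightOneSpectrum K[X]) :
    (adicPlace v).valuation (algebraMap K[X] K⟮X⟯ (maxGenerator v)) = WithZero.exp (-1) := by
  rw [valuation_adicPlace, HeightOneSpectrum.valuation_of_algebraMap]
  exact v.intValuation_singleton (maxGenerator_ne_zero v) (span_maxGenerator v).symm

theorem valuation_adicPlace_maxGenerator_of_ne {v w : HeightOneSpectrum K[X]} (h : v ≠ w) :
    (adicPlace v).valuation (algebraMap K[X] K⟮X⟯ (maxGenerator w)) = 1 := by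
  rw [valuation_adicPlace, HeightOneSpectrum.valuation_eq_one_iff_notMem]
  intro hmem
  apply h
  have hle : w.asIdeal ≤ v.asIdeal := by
    rw [← span_maxGenerator w]
    exact (Ideal.span_singleton_le_iff_mem _).2 hmem
  exact HeightOneSpectrum.ext (w.isMaximal.eq_of_le v.isPrime.ne_top hle).symm

/-- The residue field is K[x] modulo v: polynomials already represent all residue classes, because
the denominator of an element regular at v is invertible modulo v. -/
theorem degree_adicPlace (v : HeightOneSpectrum K[X]) :
    (adicPlace v).degree = (maxGenerator v).natDegree := by
  have hmem : ∀ p : K[X], algebraMap K[X] K⟮X⟯ p ∈ (adicPlace v).ring := fun p => by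
    rw [← Place.valuation_le_one_iff, valuation_adicPlace]
    exact v.valuation_le_one p
  let φ : K[X] →ₐ[K] (adicPlace v).ring :=
    { toRingHom := (algebraMap K[X] K⟮X⟯).codRestrict (adicPlace v).ring.toSubring hmem
      commutes' := fun c => rfl }
  let ψ : K[X] →ₐ[K] IsLocalRing.ResidueField (adicPlace v).ring :=
    (IsScalarTower.toAlgHom K (adicPlace v).ring _).comp φ
  have hψ : ∀ p, ψ p = 0 ↔ p ∈ v.asIdeal := fun p => by
    change IsLocalRing.residue _ (φ p) = 0 ↔ _
    rw [IsLocalRing.residue_eq_zero_iff, ← Place.valuation_lt_one_iff, valuation_adicPlace]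
    exact v.valuation_lt_one_iff_mem p
  have hsurj : Function.Surjective ψ := by
    intro y
    obtain ⟨⟨f, hf⟩, rfl⟩ := IsLocalRing.residue_surjective y
    have hd : f.denom ∉ v.asIdeal := by
      rw [← Place.valuation_le_one_iff, valuation_adicPlace, ← f.num_div_denom] at hf
      refine (HeightOneSpectrum.valuation_div_le_one_iff K⟮X⟯ v f.num f.denom_ne_zero ?_).1 hf
      intro h1 h2
      obtain ⟨a, b, hab⟩ := f.isCoprime_num_denom
      apply v.isPrime.ne_top
      rw [Ideal.eq_top_iff_one, ← hab]
      exact add_mem (Ideal.mul_mem_left _ _ h2) (Ideal.mul_mem_left _ _ h1)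
    obtain ⟨b, hb⟩ := v.isMaximal.exists_inv hd
    obtain ⟨i, hi, hbi⟩ := hb
    refine ⟨f.num * b, ?_⟩
    have h1 : ψ (f.denom * b) = 1 := by
      rw [← sub_eq_zero, ← map_one ψ, ← map_sub, hψ, ← hbi]
      convert v.asIdeal.neg_mem hi using 1
      ring
    have h2 : IsLocalRing.residue _ (⟨f, hf⟩ : (adicPlace v).ring) * ψ f.denom = ψ f.num := by
      change IsLocalRing.residue _ _ * IsLocalRing.residue _ (φ _) =
        IsLocalRing.residue _ (φ _)
      rw [← map_mul]
      congr 1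
      apply Subtype.ext
      change f * algebraMap K[X] K⟮X⟯ f.denom = algebraMap K[X] K⟮X⟯ f.num
      nth_rewrite 1 [← f.num_div_denom]
      exact div_mul_cancel₀ _ (by simpa using f.denom_ne_zero)
    rw [map_mul, ← h2, mul_assoc, ← map_mul, h1, mul_one]
  have hker : RingHom.ker ψ = Ideal.span {maxGenerator v} := by
    ext p
    rw [RingHom.mem_ker, hψ, span_maxGenerator]
  rw [← finrank_quotient_span_eq_natDegree (f := maxGenerator v), Place.degree, ← hker]
  exact (Ideal.quotientKerAlgEquivOfSurjective hsurj).toLinearEquiv.finrank_eq.symm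

open PlaceDivisor

/-- Every divisor of `K(x)` is equivalent to a multiple of the infinite place. -/
theorem exists_principal_add_eq_single (A : PlaceDivisor K K⟮X⟯) :
    ∃ h : K⟮X⟯, h ≠ 0 ∧ ∀ P : Place K K⟮X⟯, P.valuation h =
      WithZero.exp ((Finsupp.single (inftyPlace K) A.degree - A : PlaceDivisor K K⟮X⟯) P) := by
  induction A using Finsupp.induction_linear with
  | zero => exact ⟨1, one_ne_zero, fun P => by simp [PlaceDivisor.degree]⟩
  | add A B hA hB =>
    obtain ⟨f, hf0, hf⟩ := hA
    obtain ⟨g, hg0, hg⟩ := hB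
    refine ⟨f * g, mul_ne_zero hf0 hg0, fun P => ?_⟩
    rw [map_mul, hf, hg, ← WithZero.exp_add, ← Finsupp.add_apply, degree_add, Finsupp.single_add]
    congr 2
    abel
  | single P n =>
    rw [degree_single]
    rcases eq_inftyPlace_or_adicPlace P with rfl | ⟨v, rfl⟩
    · exact ⟨1, one_ne_zero, fun P => by simp [degree_inftyPlace]⟩
    · have h0 : algebraMap K[X] K⟮X⟯ (maxGenerator v) ≠ 0 := by
        simpa using maxGenerator_ne_zero v
      -- The generator of v has a simple zero at v, a pole of order deg v at infinity, and no other
      -- zeros or poles.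
      refine ⟨algebraMap K[X] K⟮X⟯ (maxGenerator v) ^ n, zpow_ne_zero _ h0, fun Q => ?_⟩
      rw [map_zpow₀, Finsupp.sub_apply]
      rcases eq_inftyPlace_or_adicPlace Q with rfl | ⟨w, rfl⟩
      · rw [valuation_inftyPlace_algebraMap (maxGenerator_ne_zero v), ← WithZero.exp_zsmul,
          Finsupp.single_eq_same, Finsupp.single_eq_of_ne (adicPlace_ne_inftyPlace v).symm,
          degree_adicPlace]
        simp
      · rw [Finsupp.single_eq_of_ne (adicPlace_ne_inftyPlace w)]
        rcases eq_or_ne w v with rfl | hne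
        · rw [valuation_adicPlace_maxGenerator, ← WithZero.exp_zsmul, Finsupp.single_eq_same]
          simp
        · rw [valuation_adicPlace_maxGenerator_of_ne hne,
            Finsupp.single_eq_of_ne (adicPlace_injective.ne hne)]
          simp

/-- A function without finite poles is a polynomial, and its pole order at infinity is its degree.
-/
theorem riemannRochSpace_single_inftyPlace (n : ℕ) :
    riemannRochSpace (Finsupp.single (inftyPlace K) (n : ℤ) : PlaceDivisor K K⟮X⟯) =
      (Polynomial.degreeLT K (n + 1)).map (IsScalarTower.toAlgHom K K[X] K⟮X⟯).toLinearMap := by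
  ext f
  simp only [Submodule.mem_map, mem_riemannRochSpace, AlgHom.toLinearMap_apply,
    IsScalarTower.coe_toAlgHom']
  constructor
  · intro hf
    have hint : f ∈ (algebraMap K[X] K⟮X⟯).range := by
      apply HeightOneSpectrum.mem_integers_of_valuation_le_one
      intro v
      have := hf (adicPlace v)
      rwa [valuation_adicPlace, Finsupp.single_eq_of_ne (adicPlace_ne_inftyPlace v),
        WithZero.exp_zero] at this
    obtain ⟨p, rfl⟩ := hint
    refine ⟨p, ?_, rfl⟩
    rcases eq_or_ne p 0 with rfl | hp
    · exact zero_mem _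
    have := hf (inftyPlace K)
    rw [valuation_inftyPlace_algebraMap hp, Finsupp.single_eq_same, WithZero.exp_le_exp,
      Nat.cast_le] at this
    rw [Polynomial.mem_degreeLT]
    exact (Polynomial.degree_lt_iff_coeff_zero _ _).2 fun m hm =>
      Polynomial.coeff_eq_zero_of_natDegree_lt (by omega)
  · rintro ⟨p, hp, rfl⟩ P
    rcases eq_or_ne p 0 with rfl | hp0
    · simp
    rcases eq_inftyPlace_or_adicPlace P with rfl | ⟨v, rfl⟩
    · rw [valuation_inftyPlace_algebraMap hp0, Finsupp.single_eq_same, WithZero.exp_le_exp,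
        Nat.cast_le]
      rw [Polynomial.mem_degreeLT] at hp
      have := (Polynomial.natDegree_lt_iff_degree_lt hp0).2 hp
      omega
    · rw [valuation_adicPlace, Finsupp.single_eq_of_ne (adicPlace_ne_inftyPlace v),
        WithZero.exp_zero]
      exact v.valuation_le_one p

theorem finrank_riemannRochSpace_single_inftyPlace (n : ℕ) :
    Module.finrank K
      (riemannRochSpace (Finsupp.single (inftyPlace K) (n : ℤ) : PlaceDivisor K K⟮X⟯)) =
        n + 1 := by
  have hinj : Function.Injective (IsScalarTower.toAlgHom K K[X] K⟮X⟯).toLinearMap :=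
    IsFractionRing.injective K[X] K⟮X⟯
  rw [riemannRochSpace_single_inftyPlace,
    ← (Submodule.equivMapOfInjective _ hinj _).finrank_eq,
    (Polynomial.degreeLTEquiv K (n + 1)).finrank_eq, Module.finrank_fin_fun]

theorem hasGenus_ratFunc : HasGenus K K⟮X⟯ 0 := by
  constructor
  · refine ⟨Finsupp.single (inftyPlace K) ((0 : ℕ) : ℤ), ?_⟩
    rw [finrank_riemannRochSpace_single_inftyPlace, degree_single]
    simp
  · rintro n ⟨A, rfl⟩
    obtain ⟨h, h0, hh⟩ := exists_principal_add_eq_single A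
    rw [← finrank_riemannRochSpace_add A _ h h0 hh, add_sub_cancel]
    -- After reduction to a multiple of the infinite place, nonnegative degree gives exactly 0; in
    -- negative degree the bound is trivial because dimensions are nonnegative.
    rcases le_or_gt 0 A.degree with hA | hA
    · obtain ⟨m, hm⟩ := Int.eq_ofNat_of_zero_le hA
      rw [hm, finrank_riemannRochSpace_single_inftyPlace]
      push_cast
      omega
    · omega

end RationalFunctionField

/-! ### Quadratic extensions: conjugation, trace and norm -/

/-- The conjugation of a quadratic field extension, together with trace and norm. It is the
identity if the extension is inseparable. -/
structure QuadraticConj (E F : Type*) [Field E] [Field F] [Algebra E F] where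
  conj : F ≃ₐ[E] F
  tr : F → E
  nm : F → E
  algebraMap_tr : ∀ a, algebraMap E F (tr a) = a + conj a
  algebraMap_nm : ∀ a, algebraMap E F (nm a) = a * conj a

namespace QuadraticConj

section Field

variable {E F : Type*} [Field E] [Field F] [Algebra E F]

theorem exists_powerBasis (h : Module.finrank E F = 2) {w : F}
    (hw : w ∉ (algebraMap E F).range) : ∃ pb : PowerBasis E F, pb.gen = w ∧ pb.dim = 2 := by
  have : FiniteDimensional E F := Module.finite_of_finrank_pos (by omega)
  have := Subalgebra.isSimpleOrder_of_finrank h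
  have htop : Algebra.adjoin E {w} = ⊤ :=
    (eq_bot_or_eq_top _).resolve_left fun hbot =>
      hw (Algebra.mem_bot.1 (hbot ▸ Algebra.self_mem_adjoin_singleton E w))
  let pb := PowerBasis.ofAdjoinEqTop (Algebra.IsIntegral.isIntegral (R := E) w) htop
  exact ⟨pb, PowerBasis.ofAdjoinEqTop_gen _ _, by rw [← pb.finrank, h]⟩

theorem exists_eq_mul_add (h : Module.finrank E F = 2) {w : F}
    (hw : w ∉ (algebraMap E F).range) (a : F) :
    ∃ p q : E, a = algebraMap E F q * w + algebraMap E F p := by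
  obtain ⟨pb, hgen, hdim⟩ := exists_powerBasis h hw
  obtain ⟨f, hf, rfl⟩ := pb.exists_eq_aeval a
  rw [hdim] at hf
  obtain ⟨q, p, rfl⟩ := Polynomial.exists_eq_X_add_C_of_natDegree_le_one (p := f) (by omega)
  exact ⟨p, q, by simp [hgen]⟩

theorem nonempty (h : Module.finrank E F = 2) : Nonempty (QuadraticConj E F) := by
  have : FiniteDimensional E F := Module.finite_of_finrank_pos (by omega)
  have := Subalgebra.isSimpleOrder_of_finrank h
  obtain ⟨w, hw⟩ : ∃ w : F, w ∉ (algebraMap E F).range := by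
    by_contra! hall
    exact (bot_ne_top : (⊥ : Subalgebra E F) ≠ ⊤) (eq_top_iff.2 fun x _ => hall x)
  obtain ⟨pb, hgen, hdim⟩ := exists_powerBasis h hw
  have hnat : (minpoly E pb.gen).natDegree = 2 := by rw [pb.natDegree_minpoly, hdim]
  obtain ⟨b, c, hbc⟩ : ∃ b c : E, minpoly E pb.gen =
      Polynomial.X ^ 2 + Polynomial.C b * Polynomial.X + Polynomial.C c := by
    refine ⟨_, _, (?_ : _ = Polynomial.X ^ 2 + Polynomial.C ((minpoly E pb.gen).coeff 1) *
      Polynomial.X + Polynomial.C ((minpoly E pb.gen).coeff 0))⟩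
    have hm : (minpoly E pb.gen).coeff 2 = 1 := by
      rw [← hnat]; exact minpoly.monic pb.isIntegral_gen
    conv_lhs => rw [(minpoly E pb.gen).as_sum_range_C_mul_X_pow, hnat]
    simp only [Finset.sum_range_succ, Finset.sum_range_zero, hm]
    simp
    ring
  have hroot : w ^ 2 + algebraMap E F b * w + algebraMap E F c = 0 := by
    have := minpoly.aeval E pb.gen
    rw [hbc, hgen] at this
    simpa using this
  -- The other root of X ^ 2 + b X + c is -b - w. It also lies in F, so no separability is needed.
  let σ : F →ₐ[E] F := pb.lift (-algebraMap E F b - w) (by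
    rw [hbc]
    simp only [map_add, map_mul, map_pow, Polynomial.aeval_X, Polynomial.aeval_C]
    linear_combination hroot)
  have hσ : σ w = -algebraMap E F b - w := by
    rw [← hgen]; exact (pb.lift_gen _ _).trans (by rw [hgen])
  have htr : ∀ a : F, ∃ t : E, algebraMap E F t = a + σ a := by
    intro a
    obtain ⟨p, q, rfl⟩ := exists_eq_mul_add h hw a
    refine ⟨2 * p - q * b, ?_⟩
    simp only [map_add, map_sub, map_mul, AlgHom.commutes, hσ, map_ofNat]
    ring
  have hnm : ∀ a : F, ∃ t : E, algebraMap E F t = a * σ a := by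
    intro a
    obtain ⟨p, q, rfl⟩ := exists_eq_mul_add h hw a
    refine ⟨p ^ 2 - p * q * b + q ^ 2 * c, ?_⟩
    simp only [map_add, map_sub, map_mul, map_pow, AlgHom.commutes, hσ]
    linear_combination (algebraMap E F q) ^ 2 * hroot
  choose tr htr using htr
  choose nm hnm using hnm
  exact ⟨⟨AlgEquiv.ofBijective σ (Algebra.IsAlgebraic.algHom_bijective σ), tr, nm, htr, hnm⟩⟩

variable (s : QuadraticConj E F)

theorem conj_conj (a : F) : s.conj (s.conj a) = a := by
  have h := congrArg s.conj (s.algebraMap_tr a)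
  rw [AlgEquiv.commutes, map_add, s.algebraMap_tr] at h
  linear_combination -h

theorem sq_eq (a : F) : a ^ 2 = algebraMap E F (s.tr a) * a - algebraMap E F (s.nm a) := by
  rw [s.algebraMap_tr, s.algebraMap_nm]; ring

/-- Roots of monic quadratic polynomials over `R` are integral over `R`. -/
theorem _root_.isIntegral_of_add_mul {R A : Type*} [CommRing R] [CommRing A] [Algebra R A]
    {a b : A} {t n : R} (ht : algebraMap R A t = a + b) (hn : algebraMap R A n = a * b) :
    IsIntegral R a := by
  refine ⟨Polynomial.X ^ 2 - Polynomial.C t * Polynomial.X + Polynomial.C n, ?_, ?_⟩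
  · monicity!
  · simp only [Polynomial.eval₂_add, Polynomial.eval₂_sub, Polynomial.eval₂_mul,
      Polynomial.eval₂_pow, Polynomial.eval₂_X, Polynomial.eval₂_C, ht, hn]
    ring

end Field

end QuadraticConj

/-- Up to equivalence, the only valuation of K(x) that is trivial on K and has a pole at x is the
infinite one. -/
theorem Place.liesOver_inftyPlace_iff {K F : Type*} [Field K] [Field F] [Algebra K F]
    [Algebra K⟮X⟯ F] [IsScalarTower K K⟮X⟯ F] (Q : Place K F) :
    Q.LiesOver (inftyPlace K) ↔ 1 < Q.valuation (algebraMap K⟮X⟯ F RatFunc.X) := by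
  classical
  constructor
  · intro h
    by_contra hX
    rw [not_lt, Place.valuation_le_one_iff] at hX
    have : RatFunc.X ∈ (inftyPlace K).ring := by rw [← h]; exact hX
    rw [← Place.valuation_le_one_iff] at this
    exact absurd this (not_le.2 one_lt_valuation_inftyPlace_X)
  · intro h
    have : (Q.valuation.comap (algebraMap K⟮X⟯ F)).IsTrivialOn K := ⟨fun c hc => by
      rw [Valuation.comap_apply, ← IsScalarTower.algebraMap_apply, Q.valuation_algebraMap hc]⟩
    have := RatFunc.valuation_isEquiv_inftyValuation_of_one_lt_valuation_X
      (v := Q.valuation.comap (algebraMap K⟮X⟯ F)) h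
    refine SetLike.ext fun f => ?_
    rw [ValuationSubring.mem_comap, ← Place.valuation_le_one_iff, ← Valuation.comap_apply,
      Valuation.isEquiv_iff_val_le_one.1 this, ← Place.valuation_le_one_iff, valuation_inftyPlace]

/-! ### Units of the integral closure, viewed inside F -/

section IntegralUnits

variable {K F : Type*} [Field K] [Field F] [Algebra K[X] F]

/-- The nonzero elements of `F` that are units of the integral closure of `K[x]`. -/
def IsIntegralUnit (K : Type*) {F : Type*} [Field K] [Field F] [Algebra K[X] F] (u : F) : Prop :=
  u ≠ 0 ∧ IsIntegral K[X] u ∧ IsIntegral K[X] u⁻¹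

namespace IsIntegralUnit

theorem mul {u v : F} (hu : IsIntegralUnit K u) (hv : IsIntegralUnit K v) :
    IsIntegralUnit K (u * v) :=
  ⟨mul_ne_zero hu.1 hv.1, hu.2.1.mul hv.2.1, by rw [mul_inv]; exact hu.2.2.mul hv.2.2⟩

theorem inv {u : F} (hu : IsIntegralUnit K u) : IsIntegralUnit K u⁻¹ :=
  ⟨inv_ne_zero hu.1, hu.2.2, by rw [inv_inv]; exact hu.2.1⟩

theorem zpow {u : F} (hu : IsIntegralUnit K u) (n : ℤ) : IsIntegralUnit K (u ^ n) := by
  refine ⟨zpow_ne_zero _ hu.1, ?_, ?_⟩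
  · cases n with
    | ofNat n => simpa using hu.2.1.pow n
    | negSucc n => rw [zpow_negSucc, ← inv_pow]; exact hu.2.2.pow _
  · cases n with
    | ofNat n => simpa using hu.2.2.pow n
    | negSucc n => rw [zpow_negSucc, inv_inv]; exact hu.2.1.pow _

theorem of_isIntegral [Algebra K F] [IsScalarTower K K[X] F] {u : F} (h0 : u ≠ 0) (h : IsIntegral K u) :
    IsIntegralUnit K u :=
  ⟨h0, h.tower_top, h.inv.tower_top⟩

theorem algebraMap [Algebra K F] [IsScalarTower K K[X] F] {c : K} (hc : c ≠ 0) :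
    IsIntegralUnit K (algebraMap K F c) :=
  of_isIntegral (by simpa using hc) isIntegral_algebraMap

theorem coe_units (u : (integralClosure K[X] F)ˣ) :
    IsIntegralUnit K ((u : integralClosure K[X] F) : F) := by
  have h : ((u : integralClosure K[X] F) : F) * ((u⁻¹ : (integralClosure K[X] F)ˣ) :
      integralClosure K[X] F) = 1 := by
    rw [← MulMemClass.coe_mul, Units.mul_inv]; rfl
  refine ⟨left_ne_zero_of_mul_eq_one h, (u : integralClosure K[X] F).2, ?_⟩
  rw [inv_eq_of_mul_eq_one_right h]
  exact ((u⁻¹ : (integralClosure K[X] F)ˣ) : integralClosure K[X] F).2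

theorem isUnit {u : integralClosure K[X] F} (hu : IsIntegralUnit K (u : F)) : IsUnit u :=
  IsUnit.of_mul_eq_one ⟨(u : F)⁻¹, hu.2.2⟩ (Subtype.ext (mul_inv_cancel₀ hu.1))

end IsIntegralUnit

theorem unitsGenerateAdditively_iff :
    UnitsGenerateAdditively (integralClosure K[X] F) ↔
      ∀ f : F, IsIntegral K[X] f → f ∈ AddSubgroup.closure {u : F | IsIntegralUnit K u} := by
  have hmap : (AddSubgroup.closure {r : integralClosure K[X] F | IsUnit r}).map
      (integralClosure K[X] F).val.toAddMonoidHom =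
      AddSubgroup.closure {u : F | IsIntegralUnit K u} := by
    rw [AddMonoidHom.map_closure]
    congr 1
    ext u
    constructor
    · rintro ⟨r, ⟨v, rfl⟩, rfl⟩
      exact IsIntegralUnit.coe_units v
    · intro hu
      exact ⟨⟨u, hu.2.1⟩, IsIntegralUnit.isUnit hu, rfl⟩
  rw [← hmap]
  constructor
  · intro h f hf
    exact ⟨⟨f, hf⟩, by rw [h]; trivial, rfl⟩
  · intro h
    refine eq_top_iff.2 fun r _ => ?_
    obtain ⟨r', hr', he⟩ := h r r.2
    rwa [← Subtype.ext (he : (r' : F) = r)]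

end IntegralUnits

theorem unitSumNumber_eq_omega_iff {R : Type*} [Ring R] :
    unitSumNumber R = UnitSumValue.omega ↔
      (¬ ∃ k : ℕ, 0 < k ∧ IsGoodRing R k) ∧ UnitsGenerateAdditively R := by
  unfold unitSumNumber
  split_ifs with h1 h2
  · simp only [h1, not_true, false_and, iff_false, UnitSumValue.omega]
    intro h
    exact WithTop.coe_ne_top (WithTop.coe_injective h)
  · simp [h1, h2]
  · simp only [h2, and_false, iff_false, UnitSumValue.omega]
    exact WithTop.top_ne_coe

theorem RatFunc.exists_eq_algebraMap_of_isAlgebraic {K : Type*} [Field K] {e : K⟮X⟯}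
    (h : IsAlgebraic K e) : ∃ c : K, algebraMap K K⟮X⟯ c = e := by
  by_contra! hc
  refine RatFunc.transcendental_of_ne_C (f := e) ?_ h
  rintro ⟨c, rfl⟩
  exact hc c rfl

/-! ### Traces and norms of units; consequences of additive generation -/

section QuadraticFunctionField

variable {K F : Type*} [Field K] [Field F]

theorem algebraMap_C_eq [Algebra K F] [Algebra K[X] F] [IsScalarTower K K[X] F] (c : K) :
    algebraMap K[X] F (Polynomial.C c) = algebraMap K F c :=
  (IsScalarTower.algebraMap_apply K K[X] F c).symm

variable [Algebra K⟮X⟯ F]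

theorem QuadraticConj.conj_algebraMap [Algebra K F] [IsScalarTower K K⟮X⟯ F]
    (s : QuadraticConj K⟮X⟯ F) (c : K) : s.conj (algebraMap K F c) = algebraMap K F c := by
  rw [IsScalarTower.algebraMap_apply K K⟮X⟯ F, AlgEquiv.commutes]

variable [Algebra K[X] F] [IsScalarTower K[X] K⟮X⟯ F]

theorem algebraMap_polynomial_injective : Function.Injective (algebraMap K[X] F) := by
  rw [IsScalarTower.algebraMap_eq K[X] K⟮X⟯ F]
  exact (algebraMap K⟮X⟯ F).injective.comp (IsFractionRing.injective K[X] K⟮X⟯)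

theorem exists_polynomial_of_isIntegral {e : K⟮X⟯}
    (h : IsIntegral K[X] (algebraMap K⟮X⟯ F e)) : ∃ p : K[X], algebraMap K[X] K⟮X⟯ p = e :=
  IsIntegrallyClosed.isIntegral_iff.1
    ((isIntegral_algebraMap_iff (algebraMap K⟮X⟯ F).injective).1 h)

namespace QuadraticConj

variable (s : QuadraticConj K⟮X⟯ F)

theorem isIntegral_conj {a : F} (ha : IsIntegral K[X] a) : IsIntegral K[X] (s.conj a) :=
  ha.map (s.conj.restrictScalars K[X])

theorem exists_tr_eq {a : F} (ha : IsIntegral K[X] a) :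
    ∃ p : K[X], algebraMap K[X] F p = a + s.conj a := by
  have h := ha.add (s.isIntegral_conj ha)
  rw [← s.algebraMap_tr] at h
  obtain ⟨p, hp⟩ := exists_polynomial_of_isIntegral h
  exact ⟨p, by rw [← s.algebraMap_tr, ← hp, ← IsScalarTower.algebraMap_apply]⟩

theorem exists_nm_eq {a : F} (ha : IsIntegral K[X] a) :
    ∃ p : K[X], algebraMap K[X] F p = a * s.conj a := by
  have h := ha.mul (s.isIntegral_conj ha)
  rw [← s.algebraMap_nm] at h
  obtain ⟨p, hp⟩ := exists_polynomial_of_isIntegral h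
  exact ⟨p, by rw [← s.algebraMap_nm, ← hp, ← IsScalarTower.algebraMap_apply]⟩

theorem isIntegralUnit_conj {u : F} (hu : IsIntegralUnit K u) : IsIntegralUnit K (s.conj u) :=
  ⟨by simpa using hu.1, s.isIntegral_conj hu.2.1, by
    rw [← map_inv₀]; exact s.isIntegral_conj hu.2.2⟩

end QuadraticConj

theorem algebraMap_X_transcendental [Algebra K F] [IsScalarTower K K[X] F] :
    Transcendental K (algebraMap K[X] F Polynomial.X) := by
  have := (transcendental_algebraMap_iff (R := K) (S := K[X]) (A := F)
    algebraMap_polynomial_injective).2 (Polynomial.transcendental_X K)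
  exact this

variable [Algebra K F] [IsScalarTower K K[X] F]

namespace QuadraticConj

variable (s : QuadraticConj K⟮X⟯ F)

/-- The norms of u and of its inverse are polynomials with product 1. -/
theorem exists_nm_eq_of_isIntegralUnit {u : F} (hu : IsIntegralUnit K u) :
    ∃ c : K, c ≠ 0 ∧ algebraMap K F c = u * s.conj u := by
  obtain ⟨p, hp⟩ := s.exists_nm_eq hu.2.1
  obtain ⟨q, hq⟩ := s.exists_nm_eq hu.2.2
  have hpq : p * q = 1 := by
    apply algebraMap_polynomial_injective (F := F)
    rw [map_mul, hp, hq, map_one, map_inv₀, mul_mul_mul_comm, mul_inv_cancel₀ hu.1,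
      mul_inv_cancel₀ (by simpa using hu.1), one_mul]
  obtain ⟨c, hc, rfl⟩ := Polynomial.isUnit_iff.1 (IsUnit.of_mul_eq_one q hpq)
  exact ⟨c, hc.ne_zero, by rw [← hp, algebraMap_C_eq]⟩

/-- An integral unit whose trace is constant is algebraic over `K`. -/
theorem isIntegral_of_natDegree_tr_eq_zero {u : F} (hu : IsIntegralUnit K u) {p : K[X]}
    (hp : algebraMap K[X] F p = u + s.conj u) (h0 : p.natDegree = 0) : IsIntegral K u := by
  obtain ⟨c, -, hc⟩ := s.exists_nm_eq_of_isIntegralUnit hu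
  rw [Polynomial.eq_C_of_natDegree_eq_zero h0, algebraMap_C_eq] at hp
  exact isIntegral_of_add_mul hp hc

/-- If the units generate the integral closure additively, then some unit has a nonconstant
trace. -/
theorem exists_isIntegralUnit_natDegree_tr_pos
    (h : ∀ f : F, IsIntegral K[X] f → f ∈ AddSubgroup.closure {u : F | IsIntegralUnit K u}) :
    ∃ (u : F) (p : K[X]), IsIntegralUnit K u ∧ algebraMap K[X] F p = u + s.conj u ∧
      0 < p.natDegree := by
  by_contra! hcon
  -- With constant traces, all units and hence all their sums would be algebraic over K, including
  -- x.
  have hle : AddSubgroup.closure {u : F | IsIntegralUnit K u} ≤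
      (integralClosure K F).toSubring.toAddSubgroup := by
    rw [AddSubgroup.closure_le]
    intro u hu
    obtain ⟨p, hp⟩ := s.exists_tr_eq hu.2.1
    exact s.isIntegral_of_natDegree_tr_eq_zero hu hp (Nat.le_zero.1 (hcon u p hu hp))
  have hx : IsIntegral K (algebraMap K[X] F Polynomial.X) :=
    hle (h _ isIntegral_algebraMap)
  exact algebraMap_X_transcendental hx.isAlgebraic

/-- If the units generate the integral closure additively, then every unit is up to an algebraic
factor a power of a fixed unit. -/
theorem exists_fundamental_unit
    (h : ∀ f : F, IsIntegral K[X] f → f ∈ AddSubgroup.closure {u : F | IsIntegralUnit K u}) :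
    ∃ (ε : F) (e : K[X]), IsIntegralUnit K ε ∧ algebraMap K[X] F e = ε + s.conj ε ∧
      0 < e.natDegree ∧
      ∀ u, IsIntegralUnit K u → ∃ (w : F) (k : ℤ), IsIntegral K w ∧ u = w * ε ^ k := by
  classical
  have hex : ∃ n : ℕ, ∃ (u : F) (p : K[X]), IsIntegralUnit K u ∧
      algebraMap K[X] F p = u + s.conj u ∧ 0 < p.natDegree ∧ p.natDegree = n := by
    obtain ⟨u, p, hu, hp, h0⟩ := s.exists_isIntegralUnit_natDegree_tr_pos h
    exact ⟨_, u, p, hu, hp, h0, rfl⟩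
  obtain ⟨ε, e, hε, he, he0, hn⟩ := Nat.find_spec hex
  have hmin : ∀ (u : F) (p : K[X]), IsIntegralUnit K u → algebraMap K[X] F p = u + s.conj u →
      0 < p.natDegree → e.natDegree ≤ p.natDegree := fun u p hu hp h0 => by
    rw [hn]; exact Nat.find_min' hex ⟨u, p, hu, hp, h0, rfl⟩
  obtain ⟨c, hc0, hc⟩ := s.exists_nm_eq_of_isIntegralUnit hε
  have hε' : s.conj ε = algebraMap K F c * ε⁻¹ := by
    rw [hc]; field_simp [hε.1]
  have he_ne : e ≠ 0 := by rintro rfl; simp at he0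
  refine ⟨ε, e, hε, he, he0, ?_⟩
  -- Descent on the degree m of the trace of u: one of u ε and u ε', where ε' is the conjugate of ε,
  -- has trace of smaller degree.
  suffices H : ∀ (m : ℕ) (u : F) (p : K[X]), IsIntegralUnit K u →
      algebraMap K[X] F p = u + s.conj u → p.natDegree = m →
      ∃ (w : F) (k : ℤ), IsIntegral K w ∧ u = w * ε ^ k by
    intro u hu
    obtain ⟨p, hp⟩ := s.exists_tr_eq hu.2.1
    exact H _ u p hu hp rfl
  intro m
  induction m using Nat.strong_induction_on with
  | _ m ih =>
  intro u p hu hp hm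
  rcases Nat.eq_zero_or_pos m with rfl | hm0
  · exact ⟨u, 0, s.isIntegral_of_natDegree_tr_eq_zero hu hp hm, by simp⟩
  have hnm : e.natDegree ≤ m := hm ▸ hmin u p hu hp (hm ▸ hm0)
  have hp_ne : p ≠ 0 := by rintro rfl; simp at hm; omega
  obtain ⟨d, hd0, hd⟩ := s.exists_nm_eq_of_isIntegralUnit hu
  have hu1 := hu.mul hε
  have hu2 := hu.mul (s.isIntegralUnit_conj hε)
  obtain ⟨A, hA⟩ := s.exists_tr_eq hu1.2.1
  obtain ⟨B, hB⟩ := s.exists_tr_eq hu2.2.1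
  rw [map_mul] at hA hB
  rw [s.conj_conj] at hB
  have hsum : p * e = A + B := by
    apply algebraMap_polynomial_injective (F := F)
    rw [map_mul, map_add, hA, hB, hp, he]
    ring
  -- A B = N(ε) Tr(u²) + N(u) Tr(ε²) has degree at most 2m, whereas A + B = Tr(u) Tr(ε) has degree m
  -- + deg e. So one of A, B has degree at least m + deg e, and the other degree below m.
  have hprod : A * B = Polynomial.C c * (p ^ 2 - 2 * Polynomial.C d) +
      Polynomial.C d * (e ^ 2 - 2 * Polynomial.C c) := by
    apply algebraMap_polynomial_injective (F := F)
    simp only [map_mul, map_add, map_sub, map_pow, map_ofNat, algebraMap_C_eq, hA, hB, hp, he,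
      hc, hd]
    ring
  have hdegsum : (A + B).natDegree = m + e.natDegree := by
    rw [← hsum, Polynomial.natDegree_mul hp_ne he_ne, hm]
  have hdegprod : (A * B).natDegree ≤ 2 * m := by
    rw [hprod]
    have h2 : ∀ (q : K[X]) (a b : K), q.natDegree ≤ m →
        (Polynomial.C a * (q ^ 2 - 2 * Polynomial.C b)).natDegree ≤ 2 * m := by
      intro q a b hq
      refine (Polynomial.natDegree_C_mul_le _ _).trans ?_
      refine (Polynomial.natDegree_sub_le _ _).trans (max_le ?_ ?_)
      · exact (Polynomial.natDegree_pow_le).trans (by omega)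
      · rw [← map_ofNat Polynomial.C, ← Polynomial.C_mul, Polynomial.natDegree_C]
        omega
    exact (Polynomial.natDegree_add_le _ _).trans
      (max_le (h2 _ _ _ hm.le) (h2 _ _ _ hnm))
  have hmax : m + e.natDegree ≤ max A.natDegree B.natDegree :=
    hdegsum ▸ Polynomial.natDegree_add_le A B
  have hsmall : ∀ A B : K[X], (A * B).natDegree ≤ 2 * m → m + e.natDegree ≤ A.natDegree →
      B.natDegree < m := by
    intro A B hAB hA
    rcases eq_or_ne B 0 with rfl | hB0
    · simpa using hm0
    have hA0 : A ≠ 0 := by rintro rfl; simp at hA; omega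
    rw [Polynomial.natDegree_mul hA0 hB0] at hAB
    omega
  rcases le_max_iff.1 hmax with hlarge | hlarge
  · obtain ⟨w, k, hw, hk⟩ := ih _ (hsmall A B hdegprod hlarge) _ B hu2
      (by rw [map_mul, s.conj_conj, hB]) rfl
    -- As ε' = c ε⁻¹, returning from u ε' to u costs a factor c⁻¹ ε.
    refine ⟨w * algebraMap K F c⁻¹, k + 1, hw.mul isIntegral_algebraMap, ?_⟩
    have hcF : algebraMap K F c ≠ 0 := by simpa using hc0
    rw [hε'] at hk
    rw [zpow_add_one₀ hε.1, map_inv₀]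
    have : u = (u * (algebraMap K F c * ε⁻¹)) * ((algebraMap K F c)⁻¹ * ε) := by
      field_simp [hε.1]
    rw [this, hk]; ring
  · rw [mul_comm] at hdegprod
    obtain ⟨w, k, hw, hk⟩ := ih _ (hsmall B A hdegprod hlarge) _ A hu1
      (by rw [map_mul, hA]) rfl
    refine ⟨w, k - 1, hw, ?_⟩
    rw [zpow_sub_one₀ hε.1, ← mul_assoc, ← hk, mul_assoc, mul_inv_cancel₀ hε.1, mul_one]

variable [IsScalarTower K K⟮X⟯ F]

/-- If the units generate the integral closure additively, then `K` is algebraically closed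
in `F`. -/
theorem algebraicClosure_eq_bot [PerfectField K] (s : QuadraticConj K⟮X⟯ F)
    (hquad : Module.finrank K⟮X⟯ F = 2)
    (h : ∀ f : F, IsIntegral K[X] f → f ∈ AddSubgroup.closure {u : F | IsIntegralUnit K u}) :
    algebraicClosure K F = ⊥ := by
  by_contra hne
  obtain ⟨a, ha, haK⟩ : ∃ a : F, IsAlgebraic K a ∧ a ∉ (⊥ : IntermediateField K F) := by
    by_contra! hall
    exact hne (eq_bot_iff.2 fun a ha => hall a (mem_algebraicClosure_iff.1 ha))
  have hconst : ∀ e : K⟮X⟯, IsIntegral K (algebraMap K⟮X⟯ F e) →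
      ∃ c : K, algebraMap K F c = algebraMap K⟮X⟯ F e := by
    intro e he
    obtain ⟨c, hc⟩ := RatFunc.exists_eq_algebraMap_of_isAlgebraic
      ((isIntegral_algebraMap_iff (algebraMap K⟮X⟯ F).injective).1 he).isAlgebraic
    exact ⟨c, by rw [← hc, ← IsScalarTower.algebraMap_apply]⟩
  have haE : a ∉ (algebraMap K⟮X⟯ F).range := by
    rintro ⟨e, rfl⟩
    obtain ⟨c, hc⟩ := hconst e ha.isIntegral
    exact haK (IntermediateField.mem_bot.2 ⟨c, hc⟩)
  have ha' : IsIntegral K (s.conj a) := ha.isIntegral.map (s.conj.restrictScalars K)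
  obtain ⟨t, ht⟩ : ∃ t : K, algebraMap K F t = a + s.conj a := by
    obtain ⟨t, ht⟩ := hconst (s.tr a) (by rw [s.algebraMap_tr]; exact ha.isIntegral.add ha')
    exact ⟨t, by rw [ht, s.algebraMap_tr]⟩
  obtain ⟨n, hn⟩ : ∃ n : K, algebraMap K F n = a * s.conj a := by
    obtain ⟨n, hn⟩ := hconst (s.nm a) (by rw [s.algebraMap_nm]; exact ha.isIntegral.mul ha')
    exact ⟨n, by rw [hn, s.algebraMap_nm]⟩
  -- If a were fixed, then 2 a = t and a ^ 2 = n. In characteristic 2, perfectness gives a square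
  -- root of n in K; otherwise a = t / 2. Both put a in K.
  have hconj : s.conj a ≠ a := by
    intro heq
    rw [heq] at ht hn
    by_cases h2 : (2 : K) = 0
    · have : CharP K 2 := CharTwo.of_one_ne_zero_of_two_eq_zero one_ne_zero h2
      have : Fact (Nat.Prime 2) := ⟨Nat.prime_two⟩
      have : ExpChar K 2 := ExpChar.prime Nat.prime_two
      obtain ⟨b, hb⟩ := surjective_frobenius K 2 n
      rw [frobenius_def] at hb
      have hsq : (a - algebraMap K F b) ^ 2 = 0 := by
        have h2F : (2 : F) = 0 := by rw [← map_ofNat (algebraMap K F), h2, map_zero]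
        rw [← hb, map_pow] at hn
        linear_combination -hn + (algebraMap K F b ^ 2 - a * algebraMap K F b) * h2F
      exact haK (IntermediateField.mem_bot.2
        ⟨b, (sub_eq_zero.1 (pow_eq_zero_iff two_ne_zero |>.1 hsq)).symm⟩)
    · refine haK (IntermediateField.mem_bot.2 ⟨t / 2, ?_⟩)
      have h2F : (2 : F) ≠ 0 := by
        rw [← map_ofNat (algebraMap K F)]; simpa using h2
      change algebraMap K F (t / 2) = a
      rw [map_div₀, ht, map_ofNat]
      field_simp
      ring
  obtain ⟨u, p, hu, hp, hpos⟩ := s.exists_isIntegralUnit_natDegree_tr_pos h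
  obtain ⟨c, hc0, hc⟩ := s.exists_nm_eq_of_isIntegralUnit hu
  obtain ⟨α, β, hrep⟩ := exists_eq_mul_add hquad haE u
  have hrep' : s.conj u = algebraMap K⟮X⟯ F β * s.conj a + algebraMap K⟮X⟯ F α := by
    rw [hrep, map_add, map_mul, AlgEquiv.commutes, AlgEquiv.commutes]
  have hdiff : a - s.conj a ≠ 0 := sub_ne_zero.2 hconj.symm
  have haint : IsIntegral K[X] a := ha.isIntegral.tower_top
  have hdint : IsIntegral K (a - s.conj a) := ha.isIntegral.sub ha'
  -- The coefficient of a is (u - u') / (a - a'), and a - a' is algebraic over K, so its inverse is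
  -- integral. Thus u = A + a B with polynomials A, B.
  obtain ⟨B, hB⟩ : ∃ B : K[X], algebraMap K[X] K⟮X⟯ B = β := by
    apply exists_polynomial_of_isIntegral (F := F)
    have : algebraMap K⟮X⟯ F β = (u - s.conj u) * (a - s.conj a)⁻¹ := by
      rw [hrep', hrep]; field_simp; ring
    rw [this]
    exact (hu.2.1.sub (s.isIntegral_conj hu.2.1)).mul hdint.inv.tower_top
  obtain ⟨A, hA⟩ : ∃ A : K[X], algebraMap K[X] K⟮X⟯ A = α := by
    apply exists_polynomial_of_isIntegral (F := F)
    have : algebraMap K⟮X⟯ F α = u - algebraMap K[X] F B * a := by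
      rw [IsScalarTower.algebraMap_apply K[X] K⟮X⟯ F, hB, hrep]; ring
    rw [this]
    exact hu.2.1.sub (isIntegral_algebraMap.mul haint)
  rw [← hA, ← hB, ← IsScalarTower.algebraMap_apply, ← IsScalarTower.algebraMap_apply] at hrep hrep'
  have hnorm : A ^ 2 + Polynomial.C t * A * B + Polynomial.C n * B ^ 2 = Polynomial.C c := by
    apply algebraMap_polynomial_injective (F := F)
    simp only [map_add, map_mul, map_pow, algebraMap_C_eq, ht, hn, hc]
    rw [hrep', hrep]
    ring
  -- In F[X], with a new variable X, the norm form splits as (A + a B)(A + a' B). The product is a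
  -- nonzero constant, so both factors have degree 0, and so do A, B and the trace of u.
  let φ := Polynomial.mapRingHom (algebraMap K F)
  have hφ : ∀ q, φ q = q.map (algebraMap K F) := fun q => rfl
  have hφC : ∀ r : K, φ (Polynomial.C r) = Polynomial.C (algebraMap K F r) := fun r => by
    rw [hφ, Polynomial.map_C]
  have hfac : (φ A + Polynomial.C a * φ B) * (φ A + Polynomial.C (s.conj a) * φ B) =
      Polynomial.C (algebraMap K F c) := by
    rw [← hφC, ← hnorm]
    simp only [map_add, map_mul, map_pow, hφC, ht, hn]
    ring
  have hc0' : Polynomial.C (algebraMap K F c) ≠ 0 := by simpa using hc0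
  have hdeg := congrArg Polynomial.natDegree hfac
  rw [Polynomial.natDegree_C, Polynomial.natDegree_mul (left_ne_zero_of_mul (hfac ▸ hc0'))
    (right_ne_zero_of_mul (hfac ▸ hc0'))] at hdeg
  have hB0 : B.natDegree = 0 := by
    have h1 : (Polynomial.C (a - s.conj a) * φ B).natDegree = 0 := by
      have : Polynomial.C (a - s.conj a) * φ B = (φ A + Polynomial.C a * φ B) -
          (φ A + Polynomial.C (s.conj a) * φ B) := by
        rw [map_sub]; ring
      rw [this]
      refine Nat.le_zero.1 ((Polynomial.natDegree_sub_le _ _).trans ?_)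
      omega
    rwa [Polynomial.natDegree_C_mul hdiff, hφ, Polynomial.natDegree_map] at h1
  have hA0 : A.natDegree = 0 := by
    have h1 : φ A = (φ A + Polynomial.C a * φ B) - Polynomial.C a * φ B := by ring
    rw [← Polynomial.natDegree_map (algebraMap K F), ← hφ, h1]
    refine Nat.le_zero.1 ((Polynomial.natDegree_sub_le _ _).trans (max_le (by omega) ?_))
    refine (Polynomial.natDegree_C_mul_le _ _).trans ?_
    rw [hφ, Polynomial.natDegree_map, hB0]
  have hpeq : p = 2 * A + Polynomial.C t * B := by
    apply algebraMap_polynomial_injective (F := F)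
    simp only [map_add, map_mul, map_ofNat, algebraMap_C_eq, ht, hp]
    rw [hrep', hrep]
    ring
  rw [hpeq, Polynomial.eq_C_of_natDegree_eq_zero hA0, Polynomial.eq_C_of_natDegree_eq_zero hB0,
    ← map_ofNat Polynomial.C, ← Polynomial.C_mul, ← Polynomial.C_mul, ← Polynomial.C_add,
    Polynomial.natDegree_C] at hpos
  omega

end QuadraticConj

end QuadraticFunctionField

/-! ### Generation by units implies F = K(ε), and two places at infinity -/

theorem exists_algEquiv_ratFunc {K F : Type*} [Field K] [Field F] [Algebra K F] {ε : F}
    (hε : Transcendental K ε) (h : IntermediateField.adjoin K {ε} = ⊤) :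
    ∃ ψ : K⟮X⟯ ≃ₐ[K] F, ψ RatFunc.X = ε := by
  have hinj : Function.Injective (Polynomial.aeval (R := K) ε) :=
    transcendental_iff_injective.1 hε
  let ψ : K⟮X⟯ →ₐ[K] F := RatFunc.liftAlgHom (Polynomial.aeval ε)
    (nonZeroDivisors_le_comap_nonZeroDivisors_of_injective _ hinj)
  have hX : ψ RatFunc.X = ε := by
    simp [ψ, RatFunc.liftAlgHom_apply]
  have hsurj : Function.Surjective ψ := by
    have : (⊤ : IntermediateField K F) ≤ ψ.fieldRange := by
      rw [← h, IntermediateField.adjoin_le_iff, Set.singleton_subset_iff]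
      exact ⟨_, hX⟩
    exact fun f => this (IntermediateField.mem_top (x := f))
  exact ⟨AlgEquiv.ofBijective ψ ⟨ψ.toRingHom.injective, hsurj⟩, hX⟩

section QuadraticFunctionField

variable {K F : Type*} [Field K] [Field F] [Algebra K F] [Algebra K[X] F]

theorem IntermediateField.eq_top_of_isIntegral_mem [Algebra K⟮X⟯ F] [IsScalarTower K[X] K⟮X⟯ F]
    [FiniteDimensional K⟮X⟯ F] (L : IntermediateField K F)
    (h : ∀ f : F, IsIntegral K[X] f → f ∈ L) : L = ⊤ := by
  have : IsFractionRing (integralClosure K[X] F) F :=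
    integralClosure.isFractionRing_of_finite_extension K⟮X⟯ F
  refine eq_top_iff.2 fun f _ => ?_
  obtain ⟨a, b, -, rfl⟩ := IsFractionRing.div_surjective (integralClosure K[X] F) f
  exact div_mem (h _ a.2) (h _ b.2)

theorem Place.algebraMap_polynomial_mem [IsScalarTower K K[X] F] (Q : Place K F)
    (h : algebraMap K[X] F Polynomial.X ∈ Q.ring) (p : K[X]) : algebraMap K[X] F p ∈ Q.ring := by
  induction p using Polynomial.induction_on' with
  | add p q hp hq => rw [map_add]; exact add_mem hp hq
  | monomial n a =>
    rw [← Polynomial.C_mul_X_pow_eq_monomial, map_mul, map_pow, algebraMap_C_eq]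
    exact mul_mem (Q.algebraMap_mem a) (pow_mem h n)

variable [Algebra K⟮X⟯ F] [IsScalarTower K K⟮X⟯ F] [IsScalarTower K[X] K⟮X⟯ F]
  [IsScalarTower K K[X] F]

/-- The places of `K(ε)` above the infinite place of `K(x)`, if `ε` is a fundamental unit. -/
theorem ncard_liesOver_inftyPlace (s : QuadraticConj K⟮X⟯ F) {ε : F} {e : K[X]}
    (hε : IsIntegralUnit K ε) (he : algebraMap K[X] F e = ε + s.conj ε)
    (hgen : ∀ f : F, IsIntegral K[X] f →
      f ∈ AddSubgroup.closure {u : F | ∃ (c : K) (k : ℤ), u = algebraMap K F c * ε ^ k})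
    (ψ : K⟮X⟯ ≃ₐ[K] F) (hψ : ψ RatFunc.X = ε) :
    {Q : Place K F | Q.LiesOver (inftyPlace K)}.ncard = 2 := by
  obtain ⟨c, hc0, hc⟩ := s.exists_nm_eq_of_isIntegralUnit hε
  have hε' : s.conj ε = algebraMap K F c * ε⁻¹ := by
    rw [hc]; field_simp [hε.1]
  have hXx : algebraMap K⟮X⟯ F RatFunc.X = algebraMap K[X] F Polynomial.X := by
    rw [← RatFunc.algebraMap_X, ← IsScalarTower.algebraMap_apply]
  -- If ε has value 1 at Q, all sums of terms c ε ^ k are regular at Q, among them x. If x is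
  -- regular at Q, so is the trace ε + c ε⁻¹; but if ε has a zero or pole at Q, exactly one summand
  -- has a pole there.
  have hiff : ∀ Q : Place K F, Q.LiesOver (inftyPlace K) ↔ Q.valuation ε ≠ 1 := by
    intro Q
    rw [Q.liesOver_inftyPlace_iff, hXx]
    constructor
    · intro hQ h1
      have hle : AddSubgroup.closure {u : F | ∃ (c : K) (k : ℤ), u = algebraMap K F c * ε ^ k} ≤
          Q.ring.toSubring.toAddSubgroup := by
        rw [AddSubgroup.closure_le]
        rintro _ ⟨c, k, rfl⟩
        refine Q.valuation_le_one_iff.1 ?_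
        rw [map_mul, map_zpow₀, h1, one_zpow, mul_one]
        exact PlaceDivisor.valuation_algebraMap_le_one Q c
      exact absurd (Q.valuation_le_one_iff.2 (hle (hgen _ isIntegral_algebraMap))) (not_le.2 hQ)
    · intro h1
      by_contra hX
      rw [not_lt] at hX
      have he1 : Q.valuation (algebraMap K[X] F e) ≤ 1 := by
        rw [Q.valuation_le_one_iff] at hX ⊢
        exact Q.algebraMap_polynomial_mem hX e
      have hinv : Q.valuation (s.conj ε) = (Q.valuation ε)⁻¹ := by
        rw [hε', map_mul, Q.valuation_algebraMap hc0, one_mul, map_inv₀]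
      have hv0 : 0 < Q.valuation ε := by simpa [zero_lt_iff] using hε.1
      rw [he] at he1
      rcases lt_or_gt_of_ne h1 with hlt | hgt
      · have h2 : 1 < Q.valuation (s.conj ε) := by rw [hinv]; exact (one_lt_inv₀ hv0).2 hlt
        rw [Valuation.map_add_eq_of_lt_right _ (hlt.trans h2)] at he1
        exact absurd he1 (not_le.2 h2)
      · have h2 : Q.valuation (s.conj ε) < 1 := by rw [hinv]; exact (inv_lt_one₀ hv0).2 hgt
        rw [Valuation.map_add_eq_of_lt_left _ (h2.trans hgt)] at he1
        exact absurd he1 (not_le.2 hgt)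
  let v0 : IsDedekindDomain.HeightOneSpectrum K[X] := Polynomial.idealX K
  have hv0 : (adicPlace v0).valuation RatFunc.X < 1 := by
    rw [valuation_adicPlace, ← RatFunc.algebraMap_X]
    refine (v0.valuation_lt_one_iff_mem _).2 ?_
    rw [show v0.asIdeal = Ideal.span {Polynomial.X} from Polynomial.idealX_span K]
    exact Ideal.mem_span_singleton_self _
  -- Transported to K(X) by ψ, the condition selects the pole and the zero of X.
  have hset : {Q : Place K F | Q.LiesOver (inftyPlace K)} =
      {Place.congr ψ (inftyPlace K), Place.congr ψ (adicPlace v0)} := by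
    ext Q
    obtain ⟨P, rfl⟩ := (Place.congr ψ).surjective Q
    have hval : (Place.congr ψ P).valuation ε = P.valuation RatFunc.X := by
      rw [show Place.congr ψ P = P.comap ψ.symm from rfl, Place.valuation_comap, ← hψ,
        AlgEquiv.symm_apply_apply]
    simp only [Set.mem_ofPred_eq, hiff, hval, Set.mem_insert_iff, Set.mem_singleton_iff,
      EmbeddingLike.apply_eq_iff_eq]
    constructor
    · intro hne
      rcases lt_or_gt_of_ne hne with hlt | hgt
      · right
        obtain ⟨v, rfl⟩ := exists_eq_adicPlace P hlt.le
        congr 1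
        rw [valuation_adicPlace, ← RatFunc.algebraMap_X] at hlt
        have hmem := (v.valuation_lt_one_iff_mem _).1 hlt
        have hle : v0.asIdeal ≤ v.asIdeal := by
          rw [show v0.asIdeal = Ideal.span {Polynomial.X} from Polynomial.idealX_span K]
          exact (Ideal.span_singleton_le_iff_mem _).2 hmem
        exact IsDedekindDomain.HeightOneSpectrum.ext
          (v0.isMaximal.eq_of_le v.isPrime.ne_top hle).symm
      · exact Or.inl (eq_inftyPlace_of_one_lt P hgt)
    · rintro (rfl | rfl)
      · exact one_lt_valuation_inftyPlace_X.ne'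
      · exact hv0.ne
  rw [hset, Set.ncard_pair]
  exact fun h => adicPlace_ne_inftyPlace v0 ((Place.congr ψ).injective h).symm

theorem algebraicClosure_genus_splits_of_units_generate [PerfectField K]
    (hquad : Module.finrank K⟮X⟯ F = 2)
    (h : ∀ f : F, IsIntegral K[X] f → f ∈ AddSubgroup.closure {u : F | IsIntegralUnit K u}) :
    algebraicClosure K F = ⊥ ∧ HasGenus K F 0 ∧
      {Q : Place K F | Q.LiesOver (inftyPlace K)}.ncard = 2 := by
  obtain ⟨s⟩ := QuadraticConj.nonempty hquad
  have : FiniteDimensional K⟮X⟯ F := Module.finite_of_finrank_pos (by omega)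
  have hcl := s.algebraicClosure_eq_bot hquad h
  obtain ⟨ε, e, hε, he, he0, hfund⟩ := s.exists_fundamental_unit h
  have hK : ∀ f : F, IsIntegral K f → ∃ c : K, algebraMap K F c = f := by
    intro f hf
    have : f ∈ algebraicClosure K F := mem_algebraicClosure_iff.2 hf.isAlgebraic
    rw [hcl] at this
    exact IntermediateField.mem_bot.1 this
  have hgen : ∀ f : F, IsIntegral K[X] f →
      f ∈ AddSubgroup.closure {u : F | ∃ (c : K) (k : ℤ), u = algebraMap K F c * ε ^ k} := by
    intro f hf
    refine AddSubgroup.closure_mono ?_ (h f hf)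
    intro u hu
    obtain ⟨w, k, hw, rfl⟩ := hfund u hu
    obtain ⟨c, rfl⟩ := hK w hw
    exact ⟨c, k, rfl⟩
  have htr : Transcendental K ε := by
    intro halg
    obtain ⟨c, rfl⟩ := hK ε halg.isIntegral
    have : e = Polynomial.C (c + c) := by
      apply algebraMap_polynomial_injective (F := F)
      rw [he, s.conj_algebraMap, algebraMap_C_eq, map_add]
    rw [this, Polynomial.natDegree_C] at he0
    omega
  have hadj : IntermediateField.adjoin K {ε} = ⊤ := by
    apply IntermediateField.eq_top_of_isIntegral_mem
    intro f hf
    have hle : AddSubgroup.closure {u : F | ∃ (c : K) (k : ℤ), u = algebraMap K F c * ε ^ k} ≤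
        (IntermediateField.adjoin K {ε}).toSubring.toAddSubgroup := by
      rw [AddSubgroup.closure_le]
      rintro _ ⟨c, k, rfl⟩
      exact (IntermediateField.adjoin K {ε}).mul_mem (IntermediateField.algebraMap_mem _ c)
        (zpow_mem (IntermediateField.mem_adjoin_simple_self K ε) k)
    exact hle (hgen f hf)
  obtain ⟨ψ, hψ⟩ := exists_algEquiv_ratFunc htr hadj
  exact ⟨hcl, hasGenus_ratFunc.of_algEquiv ψ, ncard_liesOver_inftyPlace s hε he hgen ψ hψ⟩

end QuadraticFunctionField

/-! ### The split infinite place: conjugate places of degree 1 -/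

theorem Place.LiesOver.isEquiv {K E F : Type*} [Field K] [Field E] [Field F] [Algebra K E]
    [Algebra K F] [Algebra E F] {Q : Place K F} {P : Place K E} (h : Q.LiesOver P) :
    (Q.valuation.comap (algebraMap E F)).IsEquiv P.valuation := by
  refine Valuation.isEquiv_iff_val_le_one.2 fun {e} => ?_
  rw [P.valuation_le_one_iff, ← h, Valuation.comap_apply, Q.valuation_le_one_iff,
    ValuationSubring.mem_comap]

section QuadraticFunctionField

variable {K F : Type*} [Field K] [Field F] [Algebra K F]

theorem Place.exists_valuation_le_one_of_ne {P Q : Place K F} (h : P ≠ Q) :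
    ∃ a : F, P.valuation a ≤ 1 ∧ 1 < Q.valuation a := by
  obtain ⟨a, ha, ha'⟩ := SetLike.not_le_iff_exists.1 fun hle => h (Place.eq_of_ring_le hle)
  exact ⟨a, P.valuation_le_one_iff.2 ha, by rwa [← not_le, Q.valuation_le_one_iff]⟩

variable [Algebra K⟮X⟯ F]

namespace QuadraticConj

variable {P Q : Place K F}

/-- The trace and norm of a lie in K(x) and are regular at P, hence at infinity and at Q. Thus a is
a root of a monic quadratic over the valuation ring of Q, which is integrally closed. -/
theorem valuation_le_one_of_conj (s : QuadraticConj K⟮X⟯ F)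
    (hP : P.LiesOver (inftyPlace K)) (hQ : Q.LiesOver (inftyPlace K))
    {a : F} (h1 : P.valuation a ≤ 1) (h2 : P.valuation (s.conj a) ≤ 1) : Q.valuation a ≤ 1 := by
  have hPQ : ∀ e : K⟮X⟯, P.valuation (algebraMap K⟮X⟯ F e) ≤ 1 →
      Q.valuation (algebraMap K⟮X⟯ F e) ≤ 1 := fun e he =>
    (Valuation.isEquiv_iff_val_le_one.1 hQ.isEquiv).2
      ((Valuation.isEquiv_iff_val_le_one.1 hP.isEquiv).1 he)
  have htr : Q.valuation (algebraMap K⟮X⟯ F (s.tr a)) ≤ 1 := hPQ _ (by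
    rw [s.algebraMap_tr]; exact Valuation.map_add_le _ h1 h2)
  have hnm : Q.valuation (algebraMap K⟮X⟯ F (s.nm a)) ≤ 1 := hPQ _ (by
    rw [s.algebraMap_nm, map_mul]; exact mul_le_one' h1 h2)
  by_contra! hlt
  have hpos : 0 < Q.valuation a := zero_lt_one.trans hlt
  have hle : Q.valuation (a ^ 2) ≤ Q.valuation a := by
    rw [s.sq_eq]
    refine (Valuation.map_sub _ _ _).trans (max_le ?_ (hnm.trans hlt.le))
    rw [map_mul]
    exact mul_le_of_le_one_left' htr
  rw [map_pow, sq] at hle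
  exact absurd hle (not_le.2 (lt_mul_of_one_lt_left hpos hlt))

variable [IsScalarTower K K⟮X⟯ F]

/-- Distinct places above the infinite place are conjugate. -/
theorem valuation_eq_valuation_conj (s : QuadraticConj K⟮X⟯ F)
    (hP : P.LiesOver (inftyPlace K))
    (hQ : Q.LiesOver (inftyPlace K)) (hne : P ≠ Q) (f : F) :
    Q.valuation f = P.valuation (s.conj f) := by
  suffices h : P.comap (s.conj.restrictScalars K) = Q by
    rw [← h, Place.valuation_comap]; rfl
  by_contra hne'
  have hR : ∀ f, (P.comap (s.conj.restrictScalars K)).valuation f = P.valuation (s.conj f) :=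
    fun f => Place.valuation_comap _ _ f
  set R := P.comap (s.conj.restrictScalars K)
  obtain ⟨a, ha1, ha2⟩ := Place.exists_valuation_le_one_of_ne hne
  obtain ⟨b, hb1, hb2⟩ := Place.exists_valuation_le_one_of_ne hne'
  have hinv : ∀ (S : Place K F) (x : F), x ≠ 0 → (1 ≤ S.valuation x⁻¹ ↔ S.valuation x ≤ 1) := by
    intro S x hx
    rw [map_inv₀]
    exact one_le_inv₀ (by simpa [zero_lt_iff] using hx)
  have hinv' : ∀ (S : Place K F) (x : F), x ≠ 0 → (S.valuation x⁻¹ < 1 ↔ 1 < S.valuation x) := by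
    intro S x hx
    rw [map_inv₀]
    exact inv_lt_one₀ (by simpa [zero_lt_iff] using hx)
  have ha0 : a ≠ 0 := by rintro rfl; simp at ha2
  have hb0 : b ≠ 0 := by rintro rfl; simp at hb2
  -- Weak approximation: c vanishes at Q but neither at P nor at its conjugate R. If neither a⁻¹ nor
  -- b⁻¹ works, their sum does. Then c⁻¹ and its conjugate are regular at P while c⁻¹ has a pole at
  -- Q.
  obtain ⟨c, hcP, hcR, hcQ⟩ : ∃ c : F, 1 ≤ P.valuation c ∧ 1 ≤ R.valuation c ∧
      Q.valuation c < 1 := by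
    by_cases h1 : 1 ≤ R.valuation a⁻¹
    · exact ⟨a⁻¹, (hinv P a ha0).2 ha1, h1, (hinv' Q a ha0).2 ha2⟩
    by_cases h2 : 1 ≤ P.valuation b⁻¹
    · exact ⟨b⁻¹, h2, (hinv R b hb0).2 hb1, (hinv' Q b hb0).2 hb2⟩
    rw [not_le] at h1 h2
    have h3 := (hinv P a ha0).2 ha1
    have h4 := (hinv R b hb0).2 hb1
    refine ⟨a⁻¹ + b⁻¹, ?_, ?_, ?_⟩
    · rwa [Valuation.map_add_eq_of_lt_left _ (h2.trans_le h3)]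
    · rwa [Valuation.map_add_eq_of_lt_right _ (h1.trans_le h4)]
    · exact Valuation.map_add_lt _ ((hinv' Q a ha0).2 ha2) ((hinv' Q b hb0).2 hb2)
  have hc0 : c ≠ 0 := by rintro rfl; simp at hcP
  have hc0' : c⁻¹ ≠ 0 := inv_ne_zero hc0
  have h1 : P.valuation c⁻¹ ≤ 1 := (hinv P _ hc0').1 (by rwa [inv_inv])
  have h2 : R.valuation c⁻¹ ≤ 1 := (hinv R _ hc0').1 (by rwa [inv_inv])
  have h3 : 1 < Q.valuation c⁻¹ := (hinv' Q _ hc0').1 (by rwa [inv_inv])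
  rw [hR] at h2
  exact absurd (s.valuation_le_one_of_conj hP hQ h1 h2) (not_le.2 h3)

/-- If the infinite place splits, then the residue fields above it are equal to `K`. -/
theorem exists_valuation_sub_lt_one (s : QuadraticConj K⟮X⟯ F)
    (hP : P.LiesOver (inftyPlace K))
    (hQ : Q.LiesOver (inftyPlace K)) (hne : P ≠ Q) (f : F) (hf : P.valuation f ≤ 1) :
    ∃ c : K, P.valuation (f - algebraMap K F c) < 1 := by
  obtain ⟨u, hu1, hu2⟩ : ∃ u : F, P.valuation (u - 1) < 1 ∧ Q.valuation u < 1 := by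
    obtain ⟨a, ha1, ha2⟩ := Place.exists_valuation_le_one_of_ne hne
    obtain ⟨b, hb1, hb2⟩ := Place.exists_valuation_le_one_of_ne hne.symm
    have hr1 : P.valuation (a / b) < 1 := by
      rw [map_div₀]
      exact (div_lt_one₀ (zero_lt_one.trans hb2)).2 (ha1.trans_lt hb2)
    have hr2 : 1 < Q.valuation (a / b) := by
      have hb0 : 0 < Q.valuation b := by
        rw [zero_lt_iff, Valuation.ne_zero_iff]
        rintro rfl
        simp at hb2
      rw [map_div₀]
      exact (one_lt_div₀ hb0).2 (hb1.trans_lt ha2)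
    set r := a / b
    have h1 : P.valuation (1 + r) = 1 := by
      rw [Valuation.map_add_eq_of_lt_left _ (by rwa [map_one]), map_one]
    have h2 : Q.valuation (1 + r) = Q.valuation r :=
      Valuation.map_add_eq_of_lt_right _ (by rwa [map_one])
    have h0 : 1 + r ≠ 0 := by
      intro h0
      rw [h0] at h1
      simp at h1
    refine ⟨(1 + r)⁻¹, ?_, ?_⟩
    · have : (1 + r)⁻¹ - 1 = -r / (1 + r) := by field_simp; ring
      rw [this, map_div₀, h1, Valuation.map_neg, div_one]
      exact hr1
    · rw [map_inv₀, h2]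
      exact (inv_lt_one₀ (zero_lt_one.trans hr2)).2 hr2
  -- The product b = f u is congruent to f at P and vanishes at Q, so its conjugate vanishes at P.
  -- Hence f is congruent at P to the trace of b, an element of K(x) with constant residue at
  -- infinity.
  have main : ∀ f : F, P.valuation f ≤ 1 → Q.valuation f ≤ 1 →
      ∃ c : K, P.valuation (f - algebraMap K F c) < 1 := by
    intro f h1 h2
    have hb1 : P.valuation (f * u - f) < 1 := by
      rw [show f * u - f = f * (u - 1) by ring, map_mul]
      exact mul_lt_one_of_nonneg_of_lt_one_right h1 zero_le hu1
    have hb2 : P.valuation (s.conj (f * u)) < 1 := by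
      rw [← s.valuation_eq_valuation_conj hP hQ hne, map_mul]
      exact mul_lt_one_of_nonneg_of_lt_one_right h2 zero_le hu2
    set b := f * u
    have htr : (inftyPlace K).valuation (s.tr b) ≤ 1 := by
      rw [← Valuation.isEquiv_iff_val_le_one.1 hP.isEquiv, Valuation.comap_apply, s.algebraMap_tr]
      refine Valuation.map_add_le _ ?_ hb2.le
      rw [show b = (b - f) + f by ring]
      exact Valuation.map_add_le _ hb1.le h1
    obtain ⟨c, hc⟩ := exists_valuation_inftyPlace_sub_lt_one _ htr
    rw [← Valuation.isEquiv_iff_val_lt_one.1 hP.isEquiv, Valuation.comap_apply, map_sub,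
      s.algebraMap_tr, ← IsScalarTower.algebraMap_apply] at hc
    refine ⟨c, ?_⟩
    rw [show f - algebraMap K F c = (b + s.conj b - algebraMap K F c) - (b - f) - s.conj b by ring]
    exact Valuation.map_sub_lt _ (Valuation.map_sub_lt _ hc hb1) hb2
  rcases hf.lt_or_eq with hlt | heq
  · exact ⟨0, by simpa using hlt⟩
  rcases le_or_gt (Q.valuation f) 1 with hQf | hQf
  · exact main f hf hQf
  have hf0 : f ≠ 0 := by rintro rfl; simp at heq
  -- When f has a pole at Q, its inverse is regular at both places, and its nonzero residue can be
  -- inverted.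
  obtain ⟨c, hc⟩ := main f⁻¹ (by rw [map_inv₀, heq, inv_one])
    (by rw [map_inv₀]; exact inv_le_one_of_one_le₀ hQf.le)
  have hc0 : c ≠ 0 := by
    rintro rfl
    rw [map_zero, sub_zero, map_inv₀, heq, inv_one] at hc
    exact lt_irrefl _ hc
  have hcF : algebraMap K F c ≠ 0 := by simpa using hc0
  refine ⟨c⁻¹, ?_⟩
  have : f - algebraMap K F c⁻¹ = -(f⁻¹ - algebraMap K F c) * (f * (algebraMap K F c)⁻¹) := by
    rw [map_inv₀]
    field_simp
    ring
  rw [this, map_mul, Valuation.map_neg, map_mul, heq, map_inv₀, P.valuation_algebraMap hc0]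
  simpa using hc

end QuadraticConj

end QuadraticFunctionField

/-! ### Powers of t, separability, and failure of k-goodness -/

/-- The powers have distinct pole orders at P, so the largest term of a relation cannot be
cancelled. -/
theorem Place.linearIndependent_zpow {K F : Type*} [Field K] [Field F] [Algebra K F]
    (P : Place K F) {t : F} (ht : P.valuation t = WithZero.exp 1) :
    LinearIndependent K (fun i : ℤ => t ^ i) := by
  rw [linearIndependent_iff]
  intro l hl
  by_contra hne
  have hS : l.support.Nonempty := Finsupp.support_nonempty_iff.2 hne
  have hval : ∀ i ∈ l.support, P.valuation (l i • t ^ i) = WithZero.exp i := by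
    intro i hi
    rw [Algebra.smul_def, map_mul, P.valuation_algebraMap (Finsupp.mem_support_iff.1 hi),
      map_zpow₀, ht, one_mul, ← WithZero.exp_zsmul]
    simp
  have hmax := l.support.max'_mem hS
  have := Valuation.map_sum_eq_of_lt P.valuation hmax (f := fun i => l i • t ^ i) (by
    intro i hi
    rw [Finset.mem_sdiff, Finset.mem_singleton] at hi
    rw [hval _ hi.1, hval _ hmax, WithZero.exp_lt_exp]
    exact lt_of_le_of_ne (l.support.le_max' i hi.1) hi.2)
  rw [Finsupp.linearCombination_apply, Finsupp.sum] at hl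
  rw [hl, hval _ hmax, map_zero] at this
  exact WithZero.exp_ne_zero this.symm

/-- A nontrivial automorphism makes the automorphism group as large as the degree, so the extension
is Galois. -/
theorem QuadraticConj.isSeparable {E F : Type*} [Field E] [Field F] [Algebra E F]
    (s : QuadraticConj E F) (hquad : Module.finrank E F = 2) {a : F} (ha : s.conj a ≠ a) :
    Algebra.IsSeparable E F := by
  have : FiniteDimensional E F := Module.finite_of_finrank_pos (by omega)
  have hle : Nat.card (F ≃ₐ[E] F) ≤ 2 := by
    rw [← hquad, Nat.card_eq_fintype_card]
    exact AlgEquiv.card_le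
  have hlt : 1 < Nat.card (F ≃ₐ[E] F) := by
    have : Nontrivial (F ≃ₐ[E] F) := ⟨s.conj, 1, fun h => ha (by rw [h]; rfl)⟩
    exact Finite.one_lt_card
  have : IsGalois E F := IsGalois.of_card_aut_eq_finrank E F (by omega)
  infer_instance

/-- If all units have the form `c * t ^ n`, then `1 + t + ... + t ^ k` is not a sum of
`k` units. -/
theorem not_isGoodRing_integralClosure {K F : Type*} [Field K] [Field F] [Algebra K F]
    [Algebra K[X] F] {P : Place K F} {t : F}
    (ht : IsIntegralUnit K t) (htP : P.valuation t = WithZero.exp 1)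
    (hunits : ∀ u : F, IsIntegralUnit K u → ∃ (c : K) (k : ℤ), u = algebraMap K F c * t ^ k)
    (k : ℕ) : ¬ IsGoodRing (integralClosure K[X] F) k := by
  intro hgood
  obtain ⟨e, he⟩ := hgood ⟨∑ i ∈ Finset.range (k + 1), t ^ i,
    IsIntegral.sum _ fun i _ => ht.2.1.pow i⟩
  have he' := congrArg (algebraMap (integralClosure K[X] F) F) he
  rw [map_sum] at he'
  choose c n hcn using fun j => hunits _ (IsIntegralUnit.coe_units (e j))
  have hlin : Finsupp.linearCombination K (fun i : ℤ => t ^ i)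
      (∑ i ∈ Finset.range (k + 1), Finsupp.single (i : ℤ) (1 : K)) =
      Finsupp.linearCombination K (fun i : ℤ => t ^ i) (∑ j, Finsupp.single (n j) (c j)) := by
    simp only [map_sum, Finsupp.linearCombination_single, one_smul, zpow_natCast]
    refine Eq.trans he' (Finset.sum_congr rfl fun j _ => ?_)
    rw [Algebra.smul_def]
    exact hcn j
  have heq := P.linearIndependent_zpow htP hlin
  -- By independence each of the k + 1 exponents 0, ..., k must occur among those of the k units.
  have hsub : (Finset.range (k + 1)).image (fun i : ℕ => (i : ℤ)) ⊆ Finset.univ.image n := by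
    intro x hx
    obtain ⟨i, hi, rfl⟩ := Finset.mem_image.1 hx
    by_contra hnot
    have hval := DFunLike.congr_fun heq (i : ℤ)
    simp only [Finsupp.finsetSum_apply, Finsupp.single_apply, Nat.cast_inj,
      Finset.sum_ite_eq', hi, if_true] at hval
    rw [Finset.sum_eq_zero] at hval
    · exact one_ne_zero hval
    · intro j _
      rw [if_neg]
      exact fun h => hnot (Finset.mem_image.2 ⟨j, Finset.mem_univ _, h⟩)
  have hcard := Finset.card_le_card hsub
  rw [Finset.card_image_of_injective _ Nat.cast_injective, Finset.card_range] at hcard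
  have := Finset.card_image_le (s := (Finset.univ : Finset (Fin k))) (f := n)
  rw [Finset.card_univ, Fintype.card_fin] at this
  omega

/-! ### Genus 0 and split infinity: the unit t and generation by units -/

section QuadraticFunctionField

variable {K F : Type*} [Field K] [Field F] [Algebra K F] [Algebra K[X] F] [Algebra K⟮X⟯ F]
  [IsScalarTower K[X] K⟮X⟯ F]

theorem Place.LiesOver.natDegree_eq_zero {P : Place K F} (hP : P.LiesOver (inftyPlace K))
    {p : K[X]} (hp : P.valuation (algebraMap K[X] F p) ≤ 1) : p.natDegree = 0 := by
  rcases eq_or_ne p 0 with rfl | hp0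
  · simp
  rw [IsScalarTower.algebraMap_apply K[X] K⟮X⟯ F, ← Valuation.comap_apply,
    Valuation.isEquiv_iff_val_le_one.1 hP.isEquiv, valuation_inftyPlace_algebraMap hp0,
    ← WithZero.exp_zero, WithZero.exp_le_exp] at hp
  omega

variable [IsScalarTower K K[X] F] [IsScalarTower K K⟮X⟯ F]

/-- The integral closure is Dedekind, so integrality can be tested at its maximal ideals. Each of
them gives a place at which x is regular, hence one not above infinity. -/
theorem isIntegral_of_valuation_le_one [FiniteDimensional K⟮X⟯ F] [Algebra.IsSeparable K⟮X⟯ F]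
    {f : F} (hf : ∀ R : Place K F, ¬ R.LiesOver (inftyPlace K) → R.valuation f ≤ 1) :
    IsIntegral K[X] f := by
  have : IsFractionRing (integralClosure K[X] F) F :=
    integralClosure.isFractionRing_of_finite_extension K⟮X⟯ F
  have : IsDedekindDomain (integralClosure K[X] F) :=
    integralClosure.isDedekindDomain K[X] K⟮X⟯ F
  have hmem : f ∈ (algebraMap (integralClosure K[X] F) F).range := by
    apply IsDedekindDomain.HeightOneSpectrum.mem_integers_of_valuation_le_one
    intro v
    let R : Place K F := Place.ofValuation (v.valuation F) (v.valuation_surjective F) fun c =>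
      v.valuation_le_one (⟨algebraMap K F c, isIntegral_algebraMap.tower_top⟩ :
        integralClosure K[X] F)
    have hR : R.valuation = v.valuation F := Place.valuation_ofValuation _ _ _
    rw [← hR]
    refine hf R fun hlies => ?_
    rw [R.liesOver_inftyPlace_iff, hR, ← RatFunc.algebraMap_X,
      ← IsScalarTower.algebraMap_apply] at hlies
    exact absurd (v.valuation_le_one (⟨algebraMap K[X] F Polynomial.X, isIntegral_algebraMap⟩ :
        integralClosure K[X] F)) (not_le.2 hlies)
  obtain ⟨g, rfl⟩ := hmem
  exact g.2

namespace QuadraticConj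

variable {P Q : Place K F}

/-- Trace and norm of f are polynomials without a pole at infinity, hence constants; so f is
algebraic over K. -/
theorem exists_algebraMap_eq (s : QuadraticConj K⟮X⟯ F) (hcl : algebraicClosure K F = ⊥)
    (hP : P.LiesOver (inftyPlace K)) (hQ : Q.LiesOver (inftyPlace K)) (hne : P ≠ Q) {f : F}
    (hf : IsIntegral K[X] f) (hfP : P.valuation f ≤ 1) (hfQ : Q.valuation f ≤ 1) :
    ∃ c : K, algebraMap K F c = f := by
  rw [s.valuation_eq_valuation_conj hP hQ hne] at hfQ
  obtain ⟨p, hp⟩ := s.exists_tr_eq hf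
  obtain ⟨q, hq⟩ := s.exists_nm_eq hf
  have hp0 := hP.natDegree_eq_zero (p := p) (by rw [hp]; exact Valuation.map_add_le _ hfP hfQ)
  have hq0 := hP.natDegree_eq_zero (p := q) (by rw [hq, map_mul]; exact mul_le_one' hfP hfQ)
  rw [Polynomial.eq_C_of_natDegree_eq_zero hp0, algebraMap_C_eq] at hp
  rw [Polynomial.eq_C_of_natDegree_eq_zero hq0, algebraMap_C_eq] at hq
  have : f ∈ algebraicClosure K F :=
    mem_algebraicClosure_iff.2 (isIntegral_of_add_mul hp hq).isAlgebraic
  rw [hcl] at this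
  exact IntermediateField.mem_bot.1 this

theorem valuation_mul_valuation_eq_one (s : QuadraticConj K⟮X⟯ F)
    (hP : P.LiesOver (inftyPlace K)) (hQ : Q.LiesOver (inftyPlace K)) (hne : P ≠ Q) {u : F}
    (hu : IsIntegralUnit K u) : P.valuation u * Q.valuation u = 1 := by
  obtain ⟨c, hc0, hc⟩ := s.exists_nm_eq_of_isIntegralUnit hu
  rw [s.valuation_eq_valuation_conj hP hQ hne, ← map_mul, ← hc, P.valuation_algebraMap hc0]

/-- In genus `0`, there is a unit with a simple pole and a simple zero above the split infinite
place. -/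
theorem exists_unit_of_hasGenus_zero (s : QuadraticConj K⟮X⟯ F)
    (hquad : Module.finrank K⟮X⟯ F = 2) (hg : HasGenus K F 0)
    (hP : P.LiesOver (inftyPlace K)) (hQ : Q.LiesOver (inftyPlace K)) (hne : P ≠ Q) :
    ∃ t : F, IsIntegralUnit K t ∧ P.valuation t = WithZero.exp 1 ∧
      Q.valuation t = WithZero.exp (-1) := by
  classical
  have : FiniteDimensional K⟮X⟯ F := Module.finite_of_finrank_pos (by omega)
  -- An element telling P and Q apart is moved by the conjugation, as the places are conjugate.
  have : Algebra.IsSeparable K⟮X⟯ F := by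
    obtain ⟨a, ha1, ha2⟩ := Place.exists_valuation_le_one_of_ne hne
    refine s.isSeparable hquad (a := a) fun ha => ?_
    rw [s.valuation_eq_valuation_conj hP hQ hne, ha] at ha2
    exact absurd ha1 (not_le.2 ha2)
  have hdP : P.degree = 1 := P.degree_eq_one (s.exists_valuation_sub_lt_one hP hQ hne)
  have hdQ : Q.degree = 1 := Q.degree_eq_one (s.exists_valuation_sub_lt_one hQ hP hne.symm)
  let A : PlaceDivisor K F := Finsupp.single P 1 + Finsupp.single Q (-1)
  have hA : A.degree = 0 := by
    rw [PlaceDivisor.degree_add, PlaceDivisor.degree_single, PlaceDivisor.degree_single, hdP, hdQ]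
    norm_num
  -- Genus 0 bounds deg A - dim L(A) + 1 by 0 for A = P - Q, of degree 0.
  have hrank : 0 < Module.finrank K A.riemannRochSpace := by
    have := hg.2 ⟨A, rfl⟩
    rw [hA] at this
    omega
  obtain ⟨⟨t, htA⟩, ht0⟩ := @exists_ne _ (Module.nontrivial_of_finrank_pos hrank) 0
  replace ht0 : t ≠ 0 := fun h => ht0 (Subtype.ext h)
  rw [PlaceDivisor.mem_riemannRochSpace] at htA
  have htP : P.valuation t ≤ WithZero.exp 1 := by
    simpa [A, Finsupp.single_apply, hne.symm] using htA P
  have htQ : Q.valuation t ≤ WithZero.exp (-1) := by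
    have := htA Q
    rwa [Finsupp.add_apply, Finsupp.single_eq_of_ne hne.symm, Finsupp.single_eq_same,
      zero_add] at this
  have hint : IsIntegral K[X] t := by
    refine isIntegral_of_valuation_le_one fun R hR => ?_
    have hRP : R ≠ P := by rintro rfl; exact hR hP
    have hRQ : R ≠ Q := by rintro rfl; exact hR hQ
    have := htA R
    rwa [Finsupp.add_apply, Finsupp.single_eq_of_ne hRP, Finsupp.single_eq_of_ne hRQ, zero_add,
      WithZero.exp_zero] at this
  have hunit : IsIntegralUnit K t := by
    refine ⟨ht0, hint, ?_⟩
    obtain ⟨q, hq⟩ := s.exists_nm_eq hint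
    -- The bounds at P and Q cancel, so the norm of t has no pole at infinity and is a nonzero
    -- constant; the conjugate of t is then its inverse up to a constant.
    have hq0 := hP.natDegree_eq_zero (p := q) (by
      rw [hq, map_mul, ← s.valuation_eq_valuation_conj hP hQ hne]
      refine (mul_le_mul' htP htQ).trans_eq ?_
      rw [← WithZero.exp_add]
      simp)
    rw [Polynomial.eq_C_of_natDegree_eq_zero hq0, algebraMap_C_eq] at hq
    have hc : algebraMap K F (q.coeff 0) ≠ 0 := by
      rw [hq]; exact mul_ne_zero ht0 (by simpa using ht0)
    have : t⁻¹ = s.conj t * algebraMap K F (q.coeff 0)⁻¹ := by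
      rw [map_inv₀, eq_mul_inv_iff_mul_eq₀ hc, hq]
      field_simp
    rw [this]
    exact (s.isIntegral_conj hint).mul isIntegral_algebraMap.tower_top
  have hmul := s.valuation_mul_valuation_eq_one hP hQ hne hunit
  obtain ⟨m, hm⟩ := P.exists_valuation_eq_exp ht0
  obtain ⟨n, hn⟩ := Q.exists_valuation_eq_exp ht0
  rw [hm, hn, ← WithZero.exp_add, ← WithZero.exp_zero, WithZero.exp_inj] at hmul
  rw [hm, WithZero.exp_le_exp] at htP
  rw [hn, WithZero.exp_le_exp] at htQ
  refine ⟨t, hunit, ?_, ?_⟩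
  · rw [hm]; congr 1; omega
  · rw [hn]; congr 1; omega

/-- Positive powers of t have poles above infinity only at P, negative ones only at Q. Subtracting a
suitable c t ^ k therefore lowers the pole order at one place without spoiling the bound at the
other. -/
theorem mem_closure_of_valuation_le (s : QuadraticConj K⟮X⟯ F) (hcl : algebraicClosure K F = ⊥)
    (hP : P.LiesOver (inftyPlace K)) (hQ : Q.LiesOver (inftyPlace K)) (hne : P ≠ Q) {t : F}
    (ht : IsIntegralUnit K t) (htP : P.valuation t = WithZero.exp 1)
    (htQ : Q.valuation t = WithZero.exp (-1)) (n m : ℕ) (f : F) (hf : IsIntegral K[X] f)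
    (hfP : P.valuation f ≤ WithZero.exp (n : ℤ)) (hfQ : Q.valuation f ≤ WithZero.exp (m : ℤ)) :
    f ∈ AddSubgroup.closure {u : F | IsIntegralUnit K u} := by
  have hmem : ∀ (c : K) (k : ℤ),
      algebraMap K F c * t ^ k ∈ AddSubgroup.closure {u : F | IsIntegralUnit K u} := by
    intro c k
    rcases eq_or_ne c 0 with rfl | hc
    · rw [map_zero, zero_mul]; exact zero_mem _
    · exact AddSubgroup.subset_closure ((IsIntegralUnit.algebraMap hc).mul (ht.zpow k))
  have hint : ∀ (c : K) (k : ℤ), IsIntegral K[X] (algebraMap K F c * t ^ k) := fun c k =>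
    IsIntegral.mul isIntegral_algebraMap.tower_top (ht.zpow k).2.1
  have hPz : ∀ k : ℤ, P.valuation (t ^ k) = WithZero.exp k := fun k => by
    rw [map_zpow₀, htP, ← WithZero.exp_zsmul]; simp
  have hQz : ∀ k : ℤ, Q.valuation (t ^ k) = WithZero.exp (-k) := fun k => by
    rw [map_zpow₀, htQ, ← WithZero.exp_zsmul]; simp
  have hle : ∀ (R : Place K F) (c : K) (k j : ℤ), R.valuation (t ^ k) ≤ WithZero.exp j →
      R.valuation (algebraMap K F c * t ^ k) ≤ WithZero.exp j := fun R c k j h => by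
    rw [map_mul]
    exact (mul_le_of_le_one_left' (PlaceDivisor.valuation_algebraMap_le_one R c)).trans h
  have hred : ∀ (R : Place K F) (g : F) (k : ℤ) (j : ℕ), R.valuation (t ^ k) =
      WithZero.exp ((j + 1 : ℕ) : ℤ) → R.valuation g ≤ WithZero.exp ((j + 1 : ℕ) : ℤ) →
      (∀ f : F, R.valuation f ≤ 1 → ∃ c : K, R.valuation (f - algebraMap K F c) < 1) →
      ∃ c : K, R.valuation (g - algebraMap K F c * t ^ k) ≤ WithZero.exp (j : ℤ) := by
    intro R g k j hk hg hR
    have htk : t ^ k ≠ 0 := zpow_ne_zero _ ht.1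
    -- The coefficient c is the residue of g / t ^ k, which cancels the leading term of g at R.
    obtain ⟨c, hc⟩ := hR (g / t ^ k) (by
      rw [map_div₀, hk]
      exact (div_le_one₀ WithZero.exp_pos).2 hg)
    refine ⟨c, ?_⟩
    rcases eq_or_ne (g - algebraMap K F c * t ^ k) 0 with h0 | h0
    · rw [h0, map_zero]; exact zero_le
    obtain ⟨i, hi⟩ := R.exists_valuation_eq_exp h0
    have heq : g / t ^ k - algebraMap K F c = (g - algebraMap K F c * t ^ k) / t ^ k := by
      field_simp
    rw [heq, map_div₀, hi, hk, ← WithZero.exp_sub, ← WithZero.exp_zero,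
      WithZero.exp_lt_exp] at hc
    rw [hi, WithZero.exp_le_exp]
    omega
  induction n generalizing f with
  | zero =>
    induction m generalizing f with
    | zero =>
      obtain ⟨c, rfl⟩ := s.exists_algebraMap_eq hcl hP hQ hne hf (by simpa using hfP)
        (by simpa using hfQ)
      simpa using hmem c 0
    | succ m ih =>
      obtain ⟨c, hc⟩ := hred Q f (-((m + 1 : ℕ) : ℤ)) m (by rw [hQz, neg_neg]) hfQ
        (s.exists_valuation_sub_lt_one hQ hP hne.symm)
      have := ih _ (hf.sub (hint c _)) ((Valuation.map_sub _ _ _).trans (max_le hfP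
        (hle P c _ _ (by rw [hPz, WithZero.exp_le_exp]; omega)))) hc
      simpa using add_mem this (hmem c (-((m + 1 : ℕ) : ℤ)))
  | succ n ih =>
    obtain ⟨c, hc⟩ := hred P f ((n + 1 : ℕ) : ℤ) n (hPz _) hfP
      (s.exists_valuation_sub_lt_one hP hQ hne)
    have := ih _ (hf.sub (hint c _)) hc ((Valuation.map_sub _ _ _).trans (max_le hfQ
        (hle Q c _ _ (by rw [hQz, WithZero.exp_le_exp]; omega))))
    simpa using add_mem this (hmem c ((n + 1 : ℕ) : ℤ))

/-- Dividing u by a power of t gives value 1 at P, hence also at Q because the two values of a unit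
multiply to 1. The quotient has no poles and is constant. -/
theorem exists_eq_mul_zpow (s : QuadraticConj K⟮X⟯ F) (hcl : algebraicClosure K F = ⊥)
    (hP : P.LiesOver (inftyPlace K)) (hQ : Q.LiesOver (inftyPlace K)) (hne : P ≠ Q) {t : F}
    (ht : IsIntegralUnit K t) (htP : P.valuation t = WithZero.exp 1) {u : F}
    (hu : IsIntegralUnit K u) : ∃ (c : K) (k : ℤ), u = algebraMap K F c * t ^ k := by
  obtain ⟨n, hn⟩ := P.exists_valuation_eq_exp hu.1
  have hw := hu.mul (ht.zpow (-n))
  have h1 : P.valuation (u * t ^ (-n)) = 1 := by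
    rw [map_mul, map_zpow₀, htP, hn, ← WithZero.exp_zsmul, ← WithZero.exp_add]
    simp
  have h2 := s.valuation_mul_valuation_eq_one hP hQ hne hw
  rw [h1, one_mul] at h2
  obtain ⟨c, hc⟩ := s.exists_algebraMap_eq hcl hP hQ hne hw.2.1 h1.le h2.le
  exact ⟨c, n, by rw [hc, mul_assoc, ← zpow_add₀ ht.1]; simp⟩

end QuadraticConj

end QuadraticFunctionField

/-! ### The equivalence -/

theorem theorem2 (K F : Type*) [Field K] [Finite K] [Field F]
    [Algebra K F] [Algebra K[X] F] [Algebra K⟮X⟯ F]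
    [IsScalarTower K K⟮X⟯ F] [IsScalarTower K[X] K⟮X⟯ F]
    (hquad : Module.finrank K⟮X⟯ F = 2) :
    unitSumNumber (integralClosure K[X] F) = UnitSumValue.omega ↔
      algebraicClosure K F = ⊥ ∧
      HasGenus K F 0 ∧
      {Q : Place K F | Q.LiesOver (inftyPlace K)}.ncard = 2 := by
  have : IsScalarTower K K[X] F := IsScalarTower.of_algebraMap_eq fun c => by
    rw [IsScalarTower.algebraMap_apply K K⟮X⟯ F, IsScalarTower.algebraMap_apply K K[X] K⟮X⟯,
      ← IsScalarTower.algebraMap_apply K[X] K⟮X⟯ F]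
  rw [unitSumNumber_eq_omega_iff, unitsGenerateAdditively_iff]
  constructor
  · rintro ⟨-, h⟩
    exact algebraicClosure_genus_splits_of_units_generate hquad h
  · rintro ⟨hcl, hg, hcard⟩
    obtain ⟨P, Q, hne, hset⟩ := Set.ncard_eq_two.1 hcard
    have hP : P.LiesOver (inftyPlace K) := by
      have : P ∈ {Q : Place K F | Q.LiesOver (inftyPlace K)} := by rw [hset]; simp
      exact this
    have hQ : Q.LiesOver (inftyPlace K) := by
      have : Q ∈ {Q : Place K F | Q.LiesOver (inftyPlace K)} := by rw [hset]; simp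
      exact this
    obtain ⟨s⟩ := QuadraticConj.nonempty hquad
    obtain ⟨t, ht, htP, htQ⟩ := s.exists_unit_of_hasGenus_zero hquad hg hP hQ hne
    refine ⟨?_, fun f hf => ?_⟩
    · rintro ⟨k, -, hk⟩
      exact not_isGoodRing_integralClosure ht htP
        (fun u hu => s.exists_eq_mul_zpow hcl hP hQ hne ht htP hu) k hk
    · have hbound : ∀ R : Place K F, ∃ n : ℕ, R.valuation f ≤ WithZero.exp (n : ℤ) := by
        intro R
        rcases eq_or_ne f 0 with rfl | hf0
        · exact ⟨0, by simp⟩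
        obtain ⟨n, hn⟩ := R.exists_valuation_eq_exp hf0
        exact ⟨n.toNat, by rw [hn, WithZero.exp_le_exp]; exact Int.self_le_toNat n⟩
      obtain ⟨n, hn⟩ := hbound P
      obtain ⟨m, hm⟩ := hbound Q
      exact s.mem_closure_of_valuation_le hcl hP hQ hne ht htP htQ n m f hf hn hm
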